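/- Notation. For $n\ge 1$ and $|z|<1$ let ${\rm Li}_n(z)=\sum_{k>0}z^k/k^n$. Let $\zeta$ be the Riemann zeta function, $\lambda(n)=\sum_{k\ge0}(2k+1)^{-n}$ for $n\ge2$, and $\beta(n)=\sum_{k\ge0}(-1)^k(2k+1)^{-n}$ for $n\ge1$. Put $L_n=(-\log 2)^n/n!$ for $n\ge0$ and $L_n=0$ for $n<0$. For integers $a_1,\dots,a_8$, extended to a sequence $(a_k)_{k\ge1}$ of period 8, put $$S_{n,p}(a_1,\dots,a_8)=\sum_{k>0}\frac{a_k}{2^{\lfloor (pk+p)/2\rfloor}\,k^n}.$$ Define $$A_n={\rm Li}_n(\tfrac12),\qquad B_n=\Re\{2^{n-1}{\rm Li}_n(\tfrac{1+i}{2})\},\qquad F_n=\Im\{2^{n-1}{\rm Li}_n(\tfrac{1+i}{2})\},$$ $$C_n=\Re\{(\tfrac23)^{n-1}{\rm Li}_n(\tfrac{i}{\sqrt8})-2^n{\rm Li}_n(\tfrac{-i}{\sqrt2})\},$$ $$D_n=\Re\{(\tfrac23)^{n-1}{\rm Li}_n(\tfrac{1+i}{4})-{\rm Li}_n(\tfrac{-i}{2})\},\qquad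 G_n=\Im\{(\tfrac23)^{n-1}{\rm Li}_n(\tfrac{1+i}{4})-{\rm Li}_n(\tfrac{-i}{2})\},$$ $$E_n=\Re\{(\tfrac25)^{n-1}{\rm Li}_n(\tfrac{1-i}{8})-2\,{\rm Li}_n(\tfrac{-i}{2})\},\qquad H_n=\Im\{(\tfrac25)^{n-1}{\rm Li}_n(\tfrac{1-i}{8})-2\,{\rm Li}_n(\tfrac{-i}{2})\},$$ and $$\overline A_n=A_n+L_n-\tfrac12\zeta(2)L_{n-2},\quad \overline B_n=B_n+\tfrac12L_n-\tfrac58\zeta(2)L_{n-2},\quad \overline C_n=C_n+\tfrac12L_n-\tfrac13\zeta(2)L_{n-2},$$ $$\overline D_n=D_n+\tfrac12L_n-\tfrac5{24}\zeta(2)L_{n-2},\quad \overline E_n=E_n+\tfrac12L_n-\tfrac7{40}\zeta(2)L_{n-2},$$ $$\overline F_n=F_n-\beta(1)L_{n-1},\quad \overline G_n=G_n-\beta(1)L_{n-1},\quad \overline H_n=H_n-\beta(1)L_{n-1}.$$ Theorem. One has $$\lambda(3)=\overline A_3=\tfrac25\overline B_3=\tfrac97\overline C_3=3\overline D_3=\tfrac{25}{6}\overline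 E_3,$$ $$\beta(3)=\tfrac{1}{32}\pi^3=\tfrac23\overline F_3-\overline G_3=\tfrac{20}{23}\overline F_3-\tfrac{25}{23}\overline H_3,$$ and $$\log^3 2=192\,S_{3,1}(0,1,0,4,0,1,0,16)-32\,S_{3,3}(4,-3,-4,-1,-4,-3,4,7),$$ $$\lambda(3)=\tfrac78\zeta(3)=6\,S_{3,1}(1,-7,-1,10,-1,-7,1,0)+4\,S_{3,3}(1,1,-1,-2,-1,1,1,0),$$ $$\beta(3)=\tfrac1{32}\pi^3=5\,S_{3,1}(1,-6,1,0,-1,6,-1,0)+\tfrac53\,S_{3,3}(1,1,1,0,-1,-1,-1,0)+2\,S_{3,5}(1,1,1,0,-1,-1,-1,0).$$ -/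

import Mathlib

/-!
Each polylogarithm extends holomorphically to the plane cut along `[1, ∞)`, where a relation between
polylogarithms is proved by differentiating it along a segment, which lowers the order by one. In
this way the Spence–Kummer relation between the trilogarithms of nine rational functions of `x` and
`y` reduces to relations between dilogarithms, and these to identities between logarithms. At the
points `(x, y) = (-1, 1/2)`, `(-1, (1+i)/2)` and `(1-i, 1/2)` all arguments are products of powers
of `i`, `1+i` and `2`. Inversion, Landen's relation and the duplication formula turn the resulting
identities into linear relations between the trilogarithms in the ladders, whose real parts involve
`ζ(3)` and whose imaginary parts involve `π³`. Since `(1+i)^8 = 16`, the same trilogarithms are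
values of the series `S`, with coefficients of period 8.
-/

namespace Ladder

noncomputable section

/-- The polylogarithm `Li_n(z) = ∑_{k>0} z^k / k^n` (used for `‖z‖ < 1`). -/
def Li (n : ℕ) (z : ℂ) : ℂ := ∑' k : ℕ, z ^ (k + 1) / ((k : ℂ) + 1) ^ n

/-- `λ(n) = ∑_{k≥0} (2k+1)^{-n}` (for `n ≥ 2`). -/
def lam (n : ℕ) : ℝ := ∑' k : ℕ, 1 / (2 * (k : ℝ) + 1) ^ n

/-- `β(n) = ∑_{k≥0} (-1)^k (2k+1)^{-n}` (for `n ≥ 1`), as the limit of the partial sums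
over `k < N`, since the series is only conditionally convergent for `n = 1`. -/
def beta (n : ℕ) : ℝ :=
  ∑'[SummationFilter.conditional ℕ] k : ℕ, (-1 : ℝ) ^ k / (2 * (k : ℝ) + 1) ^ n

/-- The real number `ζ(2)`. -/
def zetaTwo : ℝ := (riemannZeta 2).re

/-- `L_n = (-log 2)^n / n!`, with `L_n = 0` for `n < 0`. -/
def L (n : ℤ) : ℝ := if n < 0 then 0 else (-Real.log 2) ^ n.toNat / (n.toNat.factorial : ℝ)

/-- `S_{n,p}(a_1, …, a_8) = ∑_{k>0} a_k / (2^⌊(pk+p)/2⌋ k^n)`, where `a_k` has period 8.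
The summation variable is `j = k - 1`, and `a i` stands for `a_{i+1}`. -/
def S (n p : ℕ) (a : Fin 8 → ℤ) : ℝ :=
  ∑' j : ℕ, (a ⟨j % 8, Nat.mod_lt j (by norm_num)⟩ : ℝ) /
    (2 ^ ((p * (j + 1) + p) / 2) * ((j : ℝ) + 1) ^ n)

def A (n : ℕ) : ℝ := (Li n (1 / 2)).re

def B (n : ℕ) : ℝ := ((2 : ℂ) ^ ((n : ℤ) - 1) * Li n ((1 + Complex.I) / 2)).re

def C (n : ℕ) : ℝ :=
  ((2 / 3 : ℂ) ^ ((n : ℤ) - 1) * Li n (Complex.I / (√8 : ℝ))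
    - (2 : ℂ) ^ n * Li n (-Complex.I / (√2 : ℝ))).re

def D (n : ℕ) : ℝ :=
  ((2 / 3 : ℂ) ^ ((n : ℤ) - 1) * Li n ((1 + Complex.I) / 4) - Li n (-Complex.I / 2)).re

def E (n : ℕ) : ℝ :=
  ((2 / 5 : ℂ) ^ ((n : ℤ) - 1) * Li n ((1 - Complex.I) / 8) - 2 * Li n (-Complex.I / 2)).re

def F (n : ℕ) : ℝ := ((2 : ℂ) ^ ((n : ℤ) - 1) * Li n ((1 + Complex.I) / 2)).im

def G (n : ℕ) : ℝ :=
  ((2 / 3 : ℂ) ^ ((n : ℤ) - 1) * Li n ((1 + Complex.I) / 4) - Li n (-Complex.I / 2)).im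

def H (n : ℕ) : ℝ :=
  ((2 / 5 : ℂ) ^ ((n : ℤ) - 1) * Li n ((1 - Complex.I) / 8) - 2 * Li n (-Complex.I / 2)).im

def Abar (n : ℕ) : ℝ := A n + L n - 1 / 2 * zetaTwo * L ((n : ℤ) - 2)

def Bbar (n : ℕ) : ℝ := B n + 1 / 2 * L n - 5 / 8 * zetaTwo * L ((n : ℤ) - 2)

def Cbar (n : ℕ) : ℝ := C n + 1 / 2 * L n - 1 / 3 * zetaTwo * L ((n : ℤ) - 2)

def Dbar (n : ℕ) : ℝ := D n + 1 / 2 * L n - 5 / 24 * zetaTwo * L ((n : ℤ) - 2)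

def Ebar (n : ℕ) : ℝ := E n + 1 / 2 * L n - 7 / 40 * zetaTwo * L ((n : ℤ) - 2)

def Fbar (n : ℕ) : ℝ := F n - beta 1 * L ((n : ℤ) - 1)

def Gbar (n : ℕ) : ℝ := G n - beta 1 * L ((n : ℤ) - 1)

def Hbar (n : ℕ) : ℝ := H n - beta 1 * L ((n : ℤ) - 1)

end

end Ladder

namespace Ladder

open Complex Set Filter Topology

noncomputable section

section CutPlane

/-- The plane cut along `[1, ∞)`, the domain of the principal branch of the polylogarithms. -/
def cutPlane : Set ℂ := {z | 1 - z ∈ slitPlane}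

lemma mem_cutPlane_iff {z : ℂ} : z ∈ cutPlane ↔ z.re < 1 ∨ z.im ≠ 0 := by
  simp [cutPlane, mem_slitPlane_iff]

lemma one_sub_mem_cutPlane {z : ℂ} : 1 - z ∈ cutPlane ↔ z ∈ slitPlane := by simp [cutPlane]

lemma isOpen_cutPlane : IsOpen cutPlane :=
  isOpen_slitPlane.preimage (continuous_const.sub continuous_id)

lemma zero_mem_cutPlane : (0 : ℂ) ∈ cutPlane := by simp [cutPlane]

lemma ne_one_of_mem_cutPlane {z : ℂ} (hz : z ∈ cutPlane) : z ≠ 1 := by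
  rintro rfl
  simp [cutPlane] at hz

lemma mem_cutPlane_of_norm_le_one {z : ℂ} (hz : ‖z‖ ≤ 1) (hz1 : z ≠ 1) : z ∈ cutPlane := by
  refine mem_cutPlane_iff.2 (or_iff_not_imp_right.2 fun him => ?_)
  exact ((re_le_norm z).trans hz).lt_of_ne fun hre => hz1 (Complex.ext hre (not_not.1 him))

lemma mem_cutPlane_of_norm_lt_one {z : ℂ} (hz : ‖z‖ < 1) : z ∈ cutPlane :=
  mem_cutPlane_iff.2 (Or.inl ((re_le_norm z).trans_lt hz))

lemma starConvex_cutPlane : StarConvex ℝ 0 cutPlane := by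
  intro z hz a b ha hb hab
  simp only [mem_cutPlane_iff, smul_zero, zero_add, smul_re, smul_im, smul_eq_mul] at hz ⊢
  rcases hb.eq_or_lt with rfl | hb
  · simp
  · exact hz.imp (fun h => by nlinarith) (mul_ne_zero hb.ne')

lemma inv_mem_slitPlane {z : ℂ} (hz : z ∈ slitPlane) : z⁻¹ ∈ slitPlane := by
  have := normSq_pos.2 (slitPlane_ne_zero hz)
  simpa [mem_slitPlane_iff, this, this.ne'] using hz

lemma one_add_mem_slitPlane {z : ℂ} (hz : z ∈ slitPlane) : 1 + z ∈ slitPlane :=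
  hz.imp (fun h => by simp; linarith) (fun h => by simpa using h)

lemma neg_mem_cutPlane {z : ℂ} (hz : z ∈ slitPlane) : -z ∈ cutPlane := by
  simpa [cutPlane] using one_add_mem_slitPlane hz

lemma segment_one_subset_slitPlane {z : ℂ} (hz : z ∈ slitPlane) : segment ℝ 1 z ⊆ slitPlane :=
  starConvex_one_slitPlane.segment_subset hz

lemma log_inv_of_mem_slitPlane {z : ℂ} (hz : z ∈ slitPlane) : log z⁻¹ = -log z :=
  log_inv z (mem_slitPlane_iff_arg.1 hz).1

end CutPlane

section Segments

lemma ne_left_of_mem_openSegment {E : Type*} [AddCommGroup E] [Module ℝ E] {p q x : E}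
    (hpq : p ≠ q) (hx : x ∈ openSegment ℝ p q) : x ≠ p := by
  rintro rfl
  exact hpq (left_mem_openSegment_iff.1 hx)

lemma norm_lt_one_of_mem_openSegment {E : Type*} [NormedAddCommGroup E] [NormedSpace ℝ E]
    [StrictConvexSpace ℝ E] {p q x : E} (hp : ‖p‖ ≤ 1) (hq : ‖q‖ ≤ 1) (hpq : p ≠ q)
    (hx : x ∈ openSegment ℝ p q) : ‖x‖ < 1 := by
  have := openSegment_subset_ball_of_ne (z := (0 : E)) (r := 1) (by simpa using hp)
    (by simpa using hq) hpq hx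
  simpa using this

lemma norm_le_one_of_mem_segment {E : Type*} [NormedAddCommGroup E] [NormedSpace ℝ E]
    {p q x : E} (hp : ‖p‖ ≤ 1) (hq : ‖q‖ ≤ 1) (hx : x ∈ segment ℝ p q) : ‖x‖ ≤ 1 := by
  have := (convex_closedBall (0 : E) 1).segment_subset (by simpa using hp) (by simpa using hq) hx
  simpa using this

lemma eqOn_of_exp_eqOn {X : Type*} [TopologicalSpace X] {s : Set X} {f g : X → ℂ}
    (hs : IsPreconnected s) (hf : ContinuousOn f s) (hg : ContinuousOn g s)
    (hfg : ∀ x ∈ s, exp (f x) = exp (g x)) {a : X} (ha : a ∈ s) (hfga : f a = g a) :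
    EqOn f g s :=
  isCoveringMap_exp.eqOn_of_comp_eqOn hs hf hg (fun x hx => Subtype.ext (hfg x hx)) ha hfga

lemma eq_of_hasDerivAt_zero_on_openSegment {E : Type*} [NormedAddCommGroup E] [NormedSpace ℂ E]
    {f : ℂ → E} {p q : ℂ} (hf : ContinuousOn f (segment ℝ p q))
    (hf' : ∀ x ∈ openSegment ℝ p q, HasDerivAt f 0 x) : f q = f p := by
  have hcont : ContinuousOn (fun t => f (AffineMap.lineMap p q t)) (Icc (0 : ℝ) 1) :=
    hf.comp (by fun_prop) (segment_eq_image_lineMap ℝ p q ▸ mapsTo_image _ _)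
  have hderiv : ∀ t ∈ Ioo (0 : ℝ) 1, HasDerivAt (fun t => f (AffineMap.lineMap p q t)) 0 t := by
    intro t ht
    have hmem : AffineMap.lineMap p q t ∈ openSegment ℝ p q :=
      openSegment_eq_image_lineMap ℝ p q ▸ mem_image_of_mem _ ht
    exact ((hf' _ hmem).scomp t AffineMap.hasDerivAt_lineMap).congr_deriv (smul_zero _)
  obtain ⟨c, hc⟩ := isOpen_Ioo.exists_is_const_of_deriv_eq_zero isPreconnected_Ioo
    (fun t ht => (hderiv t ht).differentiableAt.differentiableWithinAt)
    (fun t ht => (hderiv t ht).deriv)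
  have hconst : EqOn (fun t => f (AffineMap.lineMap p q t)) (fun _ => c) (Icc (0 : ℝ) 1) :=
    EqOn.of_subset_closure hc hcont continuousOn_const Ioo_subset_Icc_self
      (closure_Ioo zero_ne_one).ge
  simpa using (hconst (right_mem_Icc.2 zero_le_one)).trans
    (hconst (left_mem_Icc.2 zero_le_one)).symm

end Segments

section Polylog

lemma exists_hasDerivAt_on_cutPlane {f : ℂ → ℂ} (hf : DifferentiableOn ℂ f cutPlane) :
    ∃ F : ℂ → ℂ, F 0 = 0 ∧ ∀ z ∈ cutPlane, HasDerivAt F (f z) z := by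
  -- The substitution `z = 1 - exp w` maps a convex strip onto the cut plane.
  set s := expOpenPartialHomeomorph.source
  have hs : Convex ℝ s := (convex_Ioo (-Real.pi) Real.pi).linear_preimage imLm
  have hmaps : MapsTo (fun w => 1 - exp w) s cutPlane := fun w hw =>
    one_sub_mem_cutPlane.2 (expOpenPartialHomeomorph.map_source hw)
  obtain ⟨G, hG⟩ := hs.exists_forall_hasDerivWithinAt
    (f := fun w => f (1 - exp w) * (-exp w))
    ((hf.comp (by fun_prop) hmaps).mul (by fun_prop))
  refine ⟨fun z => G (log (1 - z)) - G 0, by simp, fun z hz => ?_⟩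
  have hlog : log (1 - z) ∈ s := expOpenPartialHomeomorph.map_target hz
  have hG' := (hG _ hlog).hasDerivAt (expOpenPartialHomeomorph.open_source.mem_nhds hlog)
  have hlog' : HasDerivAt (fun z => log (1 - z)) (-1 / (1 - z)) z :=
    ((hasDerivAt_id z).const_sub 1).clog hz
  have h0 : 1 - z ≠ 0 := slitPlane_ne_zero hz
  refine ((hG'.comp z hlog').sub_const (G 0)).congr_deriv ?_
  rw [exp_log h0, sub_sub_cancel]
  field_simp

/-- `F` is the primitive of `f z / z` on the cut plane which vanishes at `0`. -/
structure IsLogPrimitive (F f : ℂ → ℂ) : Prop where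
  map_zero : F 0 = 0
  differentiableOn : DifferentiableOn ℂ F cutPlane
  hasDerivAt : ∀ z ∈ cutPlane, z ≠ 0 → HasDerivAt F (f z / z) z

lemma exists_isLogPrimitive {f : ℂ → ℂ} (hf : DifferentiableOn ℂ f cutPlane) (hf0 : f 0 = 0) :
    ∃ F, IsLogPrimitive F f := by
  obtain ⟨F, hF0, hF⟩ := exists_hasDerivAt_on_cutPlane
    ((differentiableOn_dslope (isOpen_cutPlane.mem_nhds zero_mem_cutPlane)).2 hf)
  refine ⟨F, hF0, fun z hz => (hF z hz).differentiableAt.differentiableWithinAt,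
    fun z hz hz0 => ?_⟩
  simpa [dslope_of_ne _ hz0, slope_def_field, hf0] using hF z hz

lemma IsLogPrimitive.eqOn {F G f : ℂ → ℂ} (hF : IsLogPrimitive F f) (hG : IsLogPrimitive G f) :
    EqOn F G cutPlane := by
  intro z hz
  rcases eq_or_ne z 0 with rfl | hz0
  · rw [hF.map_zero, hG.map_zero]
  have hseg : segment ℝ 0 z ⊆ cutPlane := starConvex_cutPlane.segment_subset hz
  have h := eq_of_hasDerivAt_zero_on_openSegment (f := fun w => F w - G w) (p := 0) (q := z)
    ((hF.differentiableOn.sub hG.differentiableOn).continuousOn.mono hseg) fun w hw => by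
      have hw' := hseg (openSegment_subset_segment ℝ _ _ hw)
      have hw0 : w ≠ 0 := ne_left_of_mem_openSegment hz0.symm hw
      exact ((hF.hasDerivAt w hw' hw0).sub (hG.hasDerivAt w hw' hw0)).congr_deriv (sub_self _)
  simpa [hF.map_zero, hG.map_zero, sub_eq_zero] using h

/-- The principal branch on the cut plane of the polylogarithm of order `n`. Orders `n ≥ 1` are
obtained from `z / (1 - z)` by repeated integration against `dz / z`. -/
def polylog : ℕ → ℂ → ℂ
  | 0 => fun z => z / (1 - z)
  | n + 1 => Classical.epsilon fun F => IsLogPrimitive F (polylog n)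

lemma differentiableOn_polylog_and_polylog_zero (n : ℕ) :
    DifferentiableOn ℂ (polylog n) cutPlane ∧ polylog n 0 = 0 := by
  induction n with
  | zero =>
    exact ⟨differentiableOn_id.div (by fun_prop) fun z hz => slitPlane_ne_zero hz,
      by simp [polylog]⟩
  | succ n ih =>
    have h : IsLogPrimitive (polylog (n + 1)) (polylog n) :=
      Classical.epsilon_spec (exists_isLogPrimitive ih.1 ih.2)
    exact ⟨h.differentiableOn, h.map_zero⟩

lemma isLogPrimitive_polylog (n : ℕ) : IsLogPrimitive (polylog (n + 1)) (polylog n) :=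
  Classical.epsilon_spec (exists_isLogPrimitive (differentiableOn_polylog_and_polylog_zero n).1
    (differentiableOn_polylog_and_polylog_zero n).2)

lemma continuousOn_polylog (n : ℕ) : ContinuousOn (polylog n) cutPlane :=
  (differentiableOn_polylog_and_polylog_zero n).1.continuousOn

@[simp]
lemma polylog_zero (n : ℕ) : polylog n 0 = 0 := (differentiableOn_polylog_and_polylog_zero n).2

lemma hasDerivAt_polylog (n : ℕ) {z : ℂ} (hz : z ∈ cutPlane) (hz0 : z ≠ 0) :
    HasDerivAt (polylog (n + 1)) (polylog n z / z) z :=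
  (isLogPrimitive_polylog n).hasDerivAt z hz hz0

lemma polylog_one {z : ℂ} (hz : z ∈ cutPlane) : polylog 1 z = -log (1 - z) := by
  have hderiv : ∀ z ∈ cutPlane, HasDerivAt (fun z : ℂ => -log (1 - z)) (1 / (1 - z)) z :=
    fun z hz => (((hasDerivAt_id z).const_sub 1).clog hz).neg.congr_deriv (by simp [neg_div])
  refine (isLogPrimitive_polylog 0).eqOn ⟨by simp, fun z hz =>
    (hderiv z hz).differentiableAt.differentiableWithinAt, fun z hz hz0 => ?_⟩ hz
  exact (hderiv z hz).congr_deriv (by simp only [polylog]; field_simp)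

end Polylog

section PowerSeries

lemma summable_one_div_succ_pow {n : ℕ} (hn : 2 ≤ n) :
    Summable fun k : ℕ => 1 / ((k : ℝ) + 1) ^ n := by
  simpa using (summable_nat_add_iff 1).2 (Real.summable_one_div_nat_pow.2 (show 1 < n by lia))

lemma norm_natCast_add_one (k : ℕ) : ‖(k : ℂ) + 1‖ = k + 1 := by
  simpa using Complex.norm_natCast (k + 1)

lemma norm_Li_term_le (n : ℕ) {z : ℂ} (hz : ‖z‖ ≤ 1) (k : ℕ) :
    ‖z ^ (k + 1) / ((k : ℂ) + 1) ^ n‖ ≤ 1 / ((k : ℝ) + 1) ^ n := by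
  rw [norm_div, norm_pow, norm_pow, norm_natCast_add_one]
  gcongr
  exact pow_le_one₀ (norm_nonneg z) hz

lemma summable_Li {n : ℕ} (hn : 2 ≤ n) {z : ℂ} (hz : ‖z‖ ≤ 1) :
    Summable fun k : ℕ => z ^ (k + 1) / ((k : ℂ) + 1) ^ n :=
  .of_norm_bounded (summable_one_div_succ_pow hn) (norm_Li_term_le n hz)

lemma continuousOn_Li {n : ℕ} (hn : 2 ≤ n) : ContinuousOn (Li n) {z | ‖z‖ ≤ 1} :=
  continuousOn_tsum (fun k => by fun_prop) (summable_one_div_succ_pow hn)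
    fun k _ hz => norm_Li_term_le n hz k

lemma Li_zero_right (n : ℕ) : Li n 0 = 0 := by simp [Li]

lemma Li_one_left {z : ℂ} (hz : ‖z‖ < 1) : Li 1 z = -log (1 - z) := by
  have h := hasSum_taylorSeries_neg_log hz
  rw [← hasSum_nat_add_iff' 1] at h
  simpa [Li] using h.tsum_eq

lemma hasDerivAt_Li (n : ℕ) {z : ℂ} (hz : ‖z‖ < 1) (hz0 : z ≠ 0) :
    HasDerivAt (Li (n + 1)) (Li n z / z) z := by
  obtain ⟨r, hzr, hr1⟩ := exists_between hz
  have hderiv : ∀ (k : ℕ) (w : ℂ), w ∈ Metric.ball (0 : ℂ) r →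
      HasDerivAt (fun w : ℂ => w ^ (k + 1) / ((k : ℂ) + 1) ^ (n + 1))
        (w ^ k / ((k : ℂ) + 1) ^ n) w := by
    intro k w _
    refine ((hasDerivAt_pow (k + 1) w).div_const _).congr_deriv ?_
    have hk : (k : ℂ) + 1 ≠ 0 := Nat.cast_add_one_ne_zero k
    push_cast
    field_simp
    ring
  have hbound : ∀ (k : ℕ) (w : ℂ), w ∈ Metric.ball (0 : ℂ) r →
      ‖w ^ k / ((k : ℂ) + 1) ^ n‖ ≤ r ^ k := by
    intro k w hw
    rw [norm_div, norm_pow, norm_pow, norm_natCast_add_one]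
    refine (div_le_self (by positivity) (one_le_pow₀ (by simp))).trans ?_
    gcongr
    simpa using (Metric.mem_ball.1 hw).le
  have h := hasDerivAt_tsum_of_isPreconnected
    (summable_geometric_of_lt_one ((norm_nonneg z).trans hzr.le) hr1) Metric.isOpen_ball
    (convex_ball (0 : ℂ) r).isPreconnected hderiv hbound
    (Metric.mem_ball_self ((norm_nonneg z).trans_lt hzr)) (by simp)
    (show z ∈ Metric.ball (0 : ℂ) r by simpa using hzr)
  refine h.congr_deriv ?_
  rw [Li, ← tsum_div_const]
  refine tsum_congr fun k => ?_
  rw [pow_succ]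
  field_simp

lemma polylog_succ_eq_Li {n : ℕ} (hn : 1 ≤ n) (h : ∀ w, ‖w‖ < 1 → polylog n w = Li n w)
    {z : ℂ} (hz : ‖z‖ ≤ 1) (hz1 : z ≠ 1) : polylog (n + 1) z = Li (n + 1) z := by
  rcases eq_or_ne z 0 with rfl | hz0
  · rw [polylog_zero, Li_zero_right]
  have hcut := starConvex_cutPlane.segment_subset (mem_cutPlane_of_norm_le_one hz hz1)
  have heq := eq_of_hasDerivAt_zero_on_openSegment
    (f := fun w => polylog (n + 1) w - Li (n + 1) w) (p := 0) (q := z)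
    (((continuousOn_polylog _).mono hcut).sub ((continuousOn_Li (by lia)).mono fun w hw =>
      norm_le_one_of_mem_segment (by simp) hz hw)) fun w hw => by
    have hw1 := norm_lt_one_of_mem_openSegment (by simp) hz hz0.symm hw
    have hw0 := ne_left_of_mem_openSegment hz0.symm hw
    have hpoly := hasDerivAt_polylog n (mem_cutPlane_of_norm_lt_one hw1) hw0
    exact (hpoly.sub (hasDerivAt_Li n hw1 hw0)).congr_deriv (by rw [h w hw1, sub_self])
  simpa [Li_zero_right, sub_eq_zero] using heq

lemma polylog_eq_Li {n : ℕ} (hn : 2 ≤ n) {z : ℂ} (hz : ‖z‖ ≤ 1) (hz1 : z ≠ 1) :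
    polylog n z = Li n z := by
  induction n, hn using Nat.le_induction generalizing z with
  | base =>
    refine polylog_succ_eq_Li le_rfl (fun w hw => ?_) hz hz1
    rw [polylog_one (mem_cutPlane_of_norm_lt_one hw), Li_one_left hw]
  | succ n hn ih =>
    exact polylog_succ_eq_Li (by lia)
      (fun w hw => ih hw.le (ne_one_of_mem_cutPlane (mem_cutPlane_of_norm_lt_one hw))) hz hz1

lemma Li_sq {n : ℕ} (hn : 2 ≤ n) {z : ℂ} (hz : ‖z‖ ≤ 1) :
    2 * Li n (z ^ 2) = 2 ^ n * (Li n z + Li n (-z)) := by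
  set f : ℕ → ℂ := fun k =>
    z ^ (k + 1) / ((k : ℂ) + 1) ^ n + (-z) ^ (k + 1) / ((k : ℂ) + 1) ^ n with hf
  have hsum : Li n z + Li n (-z) = ∑' k, f k :=
    ((summable_Li hn hz).tsum_add (summable_Li hn (by simpa using hz))).symm
  have hsupp : Function.support f ⊆ range fun k => 2 * k + 1 := by
    refine Function.support_subset_iff'.2 fun k hk => ?_
    have hk' : Odd (k + 1) := by
      rw [← Nat.not_even_iff_odd]
      rintro ⟨m, hm⟩
      exact hk ⟨m - 1, by simp only; lia⟩
    simp only [hf, hk'.neg_pow]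
    ring
  have hinj : Function.Injective fun k => 2 * k + 1 := fun a b h => by simpa using h
  rw [hsum, ← hinj.tsum_eq hsupp, Li, ← tsum_mul_left, ← tsum_mul_left]
  refine tsum_congr fun k => ?_
  have hcast : ((2 * k + 1 : ℕ) : ℂ) + 1 = 2 * (k + 1) := by push_cast; ring
  have hk : (k : ℂ) + 1 ≠ 0 := Nat.cast_add_one_ne_zero k
  simp only [hf]
  rw [hcast, Even.neg_pow ⟨k + 1, by ring⟩, mul_pow, ← pow_mul]
  field_simp
  ring

lemma Li_conj (n : ℕ) (z : ℂ) : Li n ((starRingEnd ℂ) z) = (starRingEnd ℂ) (Li n z) := by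
  simp [Li, conj_tsum]

lemma Li_one_right {n : ℕ} (hn : 2 ≤ n) : Li n 1 = riemannZeta n := by
  rw [zeta_eq_tsum_one_div_nat_add_one_cpow (by simp; lia), Li]
  simp

lemma Li_two_one : Li 2 1 = (Real.pi : ℂ) ^ 2 / 6 := by
  rw [Li_one_right le_rfl]
  exact_mod_cast riemannZeta_two

lemma Li_neg_one {n : ℕ} (hn : 2 ≤ n) : 2 ^ n * Li n (-1) = (2 - 2 ^ n) * Li n 1 := by
  have h := Li_sq hn (z := 1) (by simp)
  rw [one_pow] at h
  linear_combination -h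

end PowerSeries

section LogCurve

/-- `u` is a curve over the segment `[p, q]` in the cut plane, nonzero over the open segment,
whose logarithmic derivative there is `ℓ`. Along such a curve, differentiation lowers the order of
a polylogarithm: `d/dx polylog (n + 1) (u x) = polylog n (u x) * ℓ x`. -/
structure IsLogCurve (p q : ℂ) (u ℓ : ℂ → ℂ) : Prop where
  continuousOn : ContinuousOn u (segment ℝ p q)
  mem_cutPlane : ∀ x ∈ segment ℝ p q, u x ∈ cutPlane
  ne_zero : ∀ x ∈ openSegment ℝ p q, u x ≠ 0
  hasDerivAt : ∀ x ∈ openSegment ℝ p q, HasDerivAt u (u x * ℓ x) x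

variable {p q : ℂ} {u ℓ : ℂ → ℂ}

lemma IsLogCurve.continuousOn_polylog (h : IsLogCurve p q u ℓ) (n : ℕ) :
    ContinuousOn (fun x => polylog n (u x)) (segment ℝ p q) :=
  (Ladder.continuousOn_polylog n).comp h.continuousOn h.mem_cutPlane

lemma IsLogCurve.hasDerivAt_polylog (h : IsLogCurve p q u ℓ) (n : ℕ) {x : ℂ}
    (hx : x ∈ openSegment ℝ p q) :
    HasDerivAt (fun x => polylog (n + 1) (u x)) (polylog n (u x) * ℓ x) x := by
  have hu := h.ne_zero x hx
  have hcut := h.mem_cutPlane x (openSegment_subset_segment ℝ _ _ hx)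
  refine ((Ladder.hasDerivAt_polylog n hcut hu).comp x (h.hasDerivAt x hx)).congr_deriv ?_
  field_simp

lemma sum_polylog_succ_sub {ι : Type*} [Fintype ι] {u ℓ : ι → ℂ → ℂ} {g : ℂ → ℂ} {n : ℕ}
    (h : ∀ i, IsLogCurve p q (u i) (ℓ i)) (c : ι → ℂ) (hg : ContinuousOn g (segment ℝ p q))
    (hg' : ∀ x ∈ openSegment ℝ p q,
      HasDerivAt g (∑ i, c i * (polylog n (u i x) * ℓ i x)) x) :
    ∑ i, c i * polylog (n + 1) (u i q) - ∑ i, c i * polylog (n + 1) (u i p) = g q - g p := by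
  have heq := eq_of_hasDerivAt_zero_on_openSegment
    (f := fun x => ∑ i, c i * polylog (n + 1) (u i x) - g x) (p := p) (q := q)
    ((continuousOn_finsetSum _ fun i _ =>
      continuousOn_const.mul ((h i).continuousOn_polylog (n + 1))).sub hg) fun x hx =>
    ((HasDerivAt.fun_sum fun i _ => ((h i).hasDerivAt_polylog n hx).const_mul (c i)).sub
      (hg' x hx)).congr_deriv (sub_self _)
  linear_combination heq

end LogCurve

section FunctionalEquations

variable {z : ℂ}

lemma openSegment_one_subset_slitPlane (hz : z ∈ slitPlane) : openSegment ℝ 1 z ⊆ slitPlane :=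
  (openSegment_subset_segment ℝ 1 z).trans (segment_one_subset_slitPlane hz)

lemma continuousOn_log_segment_one (hz : z ∈ slitPlane) : ContinuousOn log (segment ℝ 1 z) :=
  continuousOn_id.clog (segment_one_subset_slitPlane hz)

lemma isLogCurve_neg (hz : z ∈ slitPlane) : IsLogCurve 1 z (fun w => -w) fun w => w⁻¹ where
  continuousOn := by fun_prop
  mem_cutPlane w hw := neg_mem_cutPlane (segment_one_subset_slitPlane hz hw)
  ne_zero w hw := neg_ne_zero.2 (slitPlane_ne_zero (openSegment_one_subset_slitPlane hz hw))
  hasDerivAt w hw := by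
    have hw0 := slitPlane_ne_zero (openSegment_one_subset_slitPlane hz hw)
    exact (hasDerivAt_id w).neg.congr_deriv (by field_simp)

lemma isLogCurve_neg_inv (hz : z ∈ slitPlane) :
    IsLogCurve 1 z (fun w => -w⁻¹) fun w => -w⁻¹ where
  continuousOn := (continuousOn_id.inv₀ fun w hw =>
    slitPlane_ne_zero (segment_one_subset_slitPlane hz hw)).neg
  mem_cutPlane w hw := neg_mem_cutPlane (inv_mem_slitPlane (segment_one_subset_slitPlane hz hw))
  ne_zero w hw := neg_ne_zero.2 <| inv_ne_zero <|
    slitPlane_ne_zero (openSegment_one_subset_slitPlane hz hw)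
  hasDerivAt w hw := by
    have hw0 := slitPlane_ne_zero (openSegment_one_subset_slitPlane hz hw)
    exact (hasDerivAt_inv hw0).neg.congr_deriv (by field_simp)

lemma isLogCurve_one_sub (hz : z ∈ slitPlane) (hz1 : z ≠ 1) :
    IsLogCurve 1 z (fun w => 1 - w) fun w => -(1 - w)⁻¹ where
  continuousOn := by fun_prop
  mem_cutPlane w hw := one_sub_mem_cutPlane.2 (segment_one_subset_slitPlane hz hw)
  ne_zero w hw := sub_ne_zero.2 (ne_left_of_mem_openSegment hz1.symm hw).symm
  hasDerivAt w hw := by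
    have hw1 := sub_ne_zero.2 (ne_left_of_mem_openSegment hz1.symm hw).symm
    exact ((hasDerivAt_id w).const_sub 1).congr_deriv (by field_simp)

lemma isLogCurve_one_sub_inv (hz : z ∈ slitPlane) (hz1 : z ≠ 1) :
    IsLogCurve 1 z (fun w => 1 - w⁻¹) fun w => -w⁻¹ - (1 - w)⁻¹ where
  continuousOn := continuousOn_const.sub (continuousOn_id.inv₀ fun w hw =>
    slitPlane_ne_zero (segment_one_subset_slitPlane hz hw))
  mem_cutPlane w hw :=
    one_sub_mem_cutPlane.2 (inv_mem_slitPlane (segment_one_subset_slitPlane hz hw))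
  ne_zero w hw := sub_ne_zero.2 fun h =>
    ne_left_of_mem_openSegment hz1.symm hw (inv_eq_one.1 h.symm)
  hasDerivAt w hw := by
    have hw0 := slitPlane_ne_zero (openSegment_one_subset_slitPlane hz hw)
    have hw1 := sub_ne_zero.2 (ne_left_of_mem_openSegment hz1.symm hw).symm
    exact ((hasDerivAt_inv hw0).const_sub 1).congr_deriv (by field_simp; ring)

lemma polylog_two_neg_one : polylog 2 (-1) = -(Real.pi : ℂ) ^ 2 / 12 := by
  have h := Li_neg_one (n := 2) le_rfl
  rw [Li_two_one] at h
  rw [polylog_eq_Li le_rfl (by simp) (by norm_num)]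
  linear_combination h / 4

lemma log_one_add_inv (hz : z ∈ slitPlane) : log (1 + z⁻¹) = log (1 + z) - log z := by
  have hseg := segment_one_subset_slitPlane hz
  refine eqOn_of_exp_eqOn (f := fun w => log (1 + w⁻¹)) (g := fun w => log (1 + w) - log w)
    (convex_segment 1 z).isPreconnected ?_ ?_ (fun w hw => ?_) (left_mem_segment ℝ 1 z) (by simp)
    (right_mem_segment ℝ 1 z)
  · exact (continuousOn_const.add (continuousOn_id.inv₀ fun w hw =>
      slitPlane_ne_zero (hseg hw))).clog fun w hw =>
        one_add_mem_slitPlane (inv_mem_slitPlane (hseg hw))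
  · exact (ContinuousOn.clog (by fun_prop) fun w hw => one_add_mem_slitPlane (hseg hw)).sub
      (continuousOn_log_segment_one hz)
  · have hw0 := slitPlane_ne_zero (hseg hw)
    rw [exp_sub, exp_log (slitPlane_ne_zero (one_add_mem_slitPlane (hseg hw))), exp_log hw0,
      exp_log (slitPlane_ne_zero (one_add_mem_slitPlane (inv_mem_slitPlane (hseg hw))))]
    field_simp
    ring

theorem polylog_two_inversion (hz : z ∈ slitPlane) :
    polylog 2 (-z) + polylog 2 (-z⁻¹) = -(Real.pi : ℂ) ^ 2 / 6 - log z ^ 2 / 2 := by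
  have h := sum_polylog_succ_sub (n := 1) (u := ![fun w => -w, fun w => -w⁻¹])
    (ℓ := ![fun w => w⁻¹, fun w => -w⁻¹]) (g := fun w => -(log w ^ 2 / 2))
    (Fin.forall_fin_two.2 ⟨isLogCurve_neg hz, isLogCurve_neg_inv hz⟩) 1
    (((continuousOn_log_segment_one hz).pow 2).div_const 2).neg fun w hw => by
    have hws := openSegment_one_subset_slitPlane hz hw
    refine (((hasDerivAt_log hws).pow 2).div_const 2).neg.congr_deriv ?_
    simp only [Fin.sum_univ_two, Pi.one_apply, one_mul, Matrix.cons_val_zero, Matrix.cons_val_one,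
      polylog_one (neg_mem_cutPlane hws), polylog_one (neg_mem_cutPlane (inv_mem_slitPlane hws)),
      sub_neg_eq_add, log_one_add_inv hws]
    push_cast
    ring
  simp only [Fin.sum_univ_two, Pi.one_apply, one_mul, Matrix.cons_val_zero, Matrix.cons_val_one,
    Nat.reduceAdd, inv_one, log_one, polylog_two_neg_one] at h
  linear_combination h

theorem polylog_three_inversion (hz : z ∈ slitPlane) :
    polylog 3 (-z) - polylog 3 (-z⁻¹) = -(Real.pi : ℂ) ^ 2 / 6 * log z - log z ^ 3 / 6 := by
  have hlog := continuousOn_log_segment_one hz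
  have h := sum_polylog_succ_sub (n := 2) (u := ![fun w => -w, fun w => -w⁻¹])
    (ℓ := ![fun w => w⁻¹, fun w => -w⁻¹])
    (g := fun w => -(Real.pi : ℂ) ^ 2 / 6 * log w - log w ^ 3 / 6)
    (Fin.forall_fin_two.2 ⟨isLogCurve_neg hz, isLogCurve_neg_inv hz⟩) ![1, -1]
    ((continuousOn_const.mul hlog).sub ((hlog.pow 3).div_const 6)) fun w hw => by
    have hws := openSegment_one_subset_slitPlane hz hw
    refine (((hasDerivAt_log hws).const_mul _).sub
      (((hasDerivAt_log hws).pow 3).div_const 6)).congr_deriv ?_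
    simp only [Fin.sum_univ_two, Matrix.cons_val_zero, Matrix.cons_val_one]
    push_cast
    linear_combination -w⁻¹ * polylog_two_inversion hws
  simp only [Fin.sum_univ_two, Matrix.cons_val_zero, Matrix.cons_val_one, inv_one, log_one] at h
  linear_combination h

theorem polylog_two_landen (hz : z ∈ slitPlane) :
    polylog 2 (1 - z) + polylog 2 (1 - z⁻¹) = -log z ^ 2 / 2 := by
  rcases eq_or_ne z 1 with rfl | hz1
  · simp
  have h := sum_polylog_succ_sub (n := 1) (u := ![fun w => 1 - w, fun w => 1 - w⁻¹])
    (ℓ := ![fun w => -(1 - w)⁻¹, fun w => -w⁻¹ - (1 - w)⁻¹]) (g := fun w => -(log w ^ 2 / 2))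
    (Fin.forall_fin_two.2 ⟨isLogCurve_one_sub hz hz1, isLogCurve_one_sub_inv hz hz1⟩) 1
    (((continuousOn_log_segment_one hz).pow 2).div_const 2).neg fun w hw => by
    have hws := openSegment_one_subset_slitPlane hz hw
    refine (((hasDerivAt_log hws).pow 2).div_const 2).neg.congr_deriv ?_
    simp only [Fin.sum_univ_two, Pi.one_apply, one_mul, Matrix.cons_val_zero, Matrix.cons_val_one,
      polylog_one (one_sub_mem_cutPlane.2 hws),
      polylog_one (one_sub_mem_cutPlane.2 (inv_mem_slitPlane hws)), sub_sub_cancel,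
      log_inv_of_mem_slitPlane hws]
    push_cast
    ring
  simp only [Fin.sum_univ_two, Pi.one_apply, one_mul, Matrix.cons_val_zero, Matrix.cons_val_one,
    inv_one, sub_self, polylog_zero, log_one] at h
  linear_combination h

lemma tendsto_mul_log_nhds_zero : Tendsto (fun z : ℂ => z * log z) (𝓝 0) (𝓝 0) := by
  have hbound : ∀ z : ℂ, ‖z * log z‖ ≤ |‖z‖ * Real.log ‖z‖| + ‖z‖ * Real.pi := fun z => by
    rw [norm_mul, abs_mul, abs_norm, ← mul_add]
    gcongr
    refine (norm_le_abs_re_add_abs_im _).trans ?_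
    rw [log_re, log_im]
    gcongr
    exact abs_arg_le_pi z
  have hcont : Continuous fun z : ℂ => |‖z‖ * Real.log ‖z‖| + ‖z‖ * Real.pi :=
    (Real.continuous_mul_log.comp continuous_norm).abs.add (by fun_prop)
  exact squeeze_zero_norm hbound (by simpa using hcont.tendsto 0)

lemma tendsto_log_mul_log_one_sub_nhds_one :
    Tendsto (fun z : ℂ => log z * log (1 - z)) (𝓝 1) (𝓝 0) := by
  have hO : (fun z : ℂ => log z) =O[𝓝 1] fun z : ℂ => 1 - z := by
    simpa using (hasDerivAt_log one_mem_slitPlane).isBigO_sub.neg_right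
  have hlim : Tendsto (fun z : ℂ => 1 - z) (𝓝 1) (𝓝 0) := by
    have hcont : Continuous fun z : ℂ => 1 - z := by fun_prop
    simpa using hcont.tendsto 1
  exact (hO.mul (Asymptotics.isBigO_refl _ _)).trans_tendsto (tendsto_mul_log_nhds_zero.comp hlim)

lemma continuousOn_log_mul_log_one_sub (hz : ‖z‖ ≤ 1) (hzs : z ∈ slitPlane) :
    ContinuousOn (fun w : ℂ => log w * log (1 - w)) (segment ℝ 1 z) := by
  refine continuousOn_of_forall_continuousAt fun w hw => ?_
  rcases eq_or_ne w 1 with rfl | hw1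
  · simpa [ContinuousAt] using tendsto_log_mul_log_one_sub_nhds_one
  · exact (continuousAt_clog (segment_one_subset_slitPlane hzs hw)).mul (ContinuousAt.clog
      (by fun_prop) (mem_cutPlane_of_norm_le_one (norm_le_one_of_mem_segment (by simp) hz hw) hw1))

theorem polylog_two_reflection (hz : ‖z‖ ≤ 1) (hzs : z ∈ slitPlane) (hz1 : z ≠ 1) :
    polylog 2 z + polylog 2 (1 - z) = (Real.pi : ℂ) ^ 2 / 6 - log z * log (1 - z) := by
  have h := sum_polylog_succ_sub (n := 1) (u := fun _ : Unit => fun w => 1 - w)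
    (g := fun w => -Li 2 w - log w * log (1 - w)) (fun _ => isLogCurve_one_sub hzs hz1) 1
    (((continuousOn_Li le_rfl).mono fun w hw =>
      norm_le_one_of_mem_segment (by simp) hz hw).neg.sub
      (continuousOn_log_mul_log_one_sub hz hzs)) fun w hw => by
    have hws := openSegment_one_subset_slitPlane hzs hw
    have hw0 := slitPlane_ne_zero hws
    have hwn := norm_lt_one_of_mem_openSegment (by simp) hz hz1.symm hw
    have hw1 : 1 - w ≠ 0 := sub_ne_zero.2 (ne_left_of_mem_openSegment hz1.symm hw).symm
    refine ((hasDerivAt_Li 1 hwn hw0).neg.sub ((hasDerivAt_log hws).mul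
      (((hasDerivAt_id w).const_sub 1).clog (mem_cutPlane_of_norm_lt_one hwn)))).congr_deriv ?_
    simp only [Fintype.sum_unique, Pi.one_apply, one_mul, Li_one_left hwn,
      polylog_one (one_sub_mem_cutPlane.2 hws), sub_sub_cancel, id]
    field_simp
    ring
  simp only [Fintype.sum_unique, Pi.one_apply, one_mul, sub_self, polylog_zero, sub_zero, log_one,
    zero_mul, Li_two_one] at h
  rw [polylog_eq_Li le_rfl hz hz1]
  linear_combination h

theorem polylog_three_landen (hz : ‖z‖ ≤ 1) (hzs : z ∈ slitPlane) (hz1 : z ≠ 1) :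
    polylog 3 z + polylog 3 (1 - z) + polylog 3 (1 - z⁻¹) = Li 3 1 + log z ^ 3 / 6
      + (Real.pi : ℂ) ^ 2 / 6 * log z - log z ^ 2 * log (1 - z) / 2 := by
  have hlog := continuousOn_log_segment_one hzs
  have h := sum_polylog_succ_sub (n := 2) (u := ![fun w => 1 - w, fun w => 1 - w⁻¹])
    (ℓ := ![fun w => -(1 - w)⁻¹, fun w => -w⁻¹ - (1 - w)⁻¹])
    (g := fun w => -Li 3 w + log w ^ 3 / 6 + (Real.pi : ℂ) ^ 2 / 6 * log w
      - log w * (log w * log (1 - w)) / 2)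
    (Fin.forall_fin_two.2 ⟨isLogCurve_one_sub hzs hz1, isLogCurve_one_sub_inv hzs hz1⟩) 1
    (((((continuousOn_Li (by norm_num)).mono fun w hw =>
      norm_le_one_of_mem_segment (by simp) hz hw).neg.add ((hlog.pow 3).div_const 6)).add
      (continuousOn_const.mul hlog)).sub
      ((hlog.mul (continuousOn_log_mul_log_one_sub hz hzs)).div_const 2)) fun w hw => by
    have hws := openSegment_one_subset_slitPlane hzs hw
    have hw0 := slitPlane_ne_zero hws
    have hwn := norm_lt_one_of_mem_openSegment (by simp) hz hz1.symm hw
    have hne := ne_left_of_mem_openSegment hz1.symm hw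
    have dlog := hasDerivAt_log hws
    have dlog' := ((hasDerivAt_id w).const_sub 1).clog (mem_cutPlane_of_norm_lt_one hwn)
    refine ((((hasDerivAt_Li 2 hwn hw0).neg.add ((dlog.pow 3).div_const 6)).add
      (dlog.const_mul _)).sub ((dlog.mul (dlog.mul dlog')).div_const 2)).congr_deriv ?_
    rw [← polylog_eq_Li le_rfl hwn.le hne]
    simp only [Fin.sum_univ_two, Pi.one_apply, one_mul, Matrix.cons_val_zero, Matrix.cons_val_one,
      Pi.mul_apply, id]
    push_cast
    linear_combination (w⁻¹ + (1 - w)⁻¹) * polylog_two_landen hws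
      - w⁻¹ * polylog_two_reflection hwn.le hws hne
  simp only [Fin.sum_univ_two, Pi.one_apply, one_mul, Matrix.cons_val_zero, Matrix.cons_val_one,
    sub_self, inv_one, polylog_zero, log_one] at h
  rw [polylog_eq_Li (by norm_num) hz hz1]
  linear_combination h

end FunctionalEquations

section SpenceKummer

variable {y x x₀ : ℂ}

/-- The arguments of the Spence–Kummer relations in the variables `x` and `y`. -/
def kummerArg (y x : ℂ) : Fin 8 → ℂ :=
  ![x * (1 - y) ^ 2 / (y * (1 - x) ^ 2), x * y, x / y, x * (1 - y) / (y * (1 - x)),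
    x * (y - 1) / (1 - x), (1 - y) / (1 - x), (y - 1) / (y * (1 - x)), x]

/-- The logarithmic derivatives of `kummerArg y x` with respect to `x`. -/
def kummerLogDeriv (x : ℂ) : Fin 8 → ℂ :=
  ![x⁻¹ + 2 * (1 - x)⁻¹, x⁻¹, x⁻¹, x⁻¹ + (1 - x)⁻¹, x⁻¹ + (1 - x)⁻¹, (1 - x)⁻¹, (1 - x)⁻¹, x⁻¹]

/-- The logarithms of `1 - kummerArg y x i`, expressed through those of `y`, `1 - x`, `1 - x * y`
and `1 - x / y`. -/
def kummerLog (y x : ℂ) : Fin 8 → ℂ :=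
  ![log (1 - x / y) + log (1 - x * y) - 2 * log (1 - x), log (1 - x * y), log (1 - x / y),
    log (1 - x / y) - log (1 - x), log (1 - x * y) - log (1 - x),
    log y + log (1 - x / y) - log (1 - x), log (1 - x * y) - log (1 - x) - log y, log (1 - x)]

/-- The condition that all arguments of the Spence–Kummer relations lie in the cut plane. -/
def KummerAdmissible (y x : ℂ) : Prop := ∀ i, kummerArg y x i ∈ cutPlane

lemma KummerAdmissible.one_sub_ne_zero (h : KummerAdmissible y x) : 1 - x ≠ 0 :=
  slitPlane_ne_zero (h 7)

lemma exp_kummerLog (hy : y ≠ 0) (h : KummerAdmissible y x) (i : Fin 8) :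
    exp (kummerLog y x i) = 1 - kummerArg y x i := by
  have ha := h.one_sub_ne_zero
  have eb : exp (log (1 - x * y)) = 1 - x * y := exp_log (slitPlane_ne_zero (h 1))
  have ec : exp (log (1 - x / y)) = 1 - x / y := exp_log (slitPlane_ne_zero (h 2))
  fin_cases i <;> dsimp [kummerLog, kummerArg] <;>
    simp only [exp_sub, exp_add, two_mul, exp_log ha, exp_log hy, eb, ec] <;> field_simp <;> ring

lemma continuousOn_kummerArg (hy : y ≠ 0) {s : Set ℂ} (hs : ∀ x ∈ s, 1 - x ≠ 0) (i : Fin 8) :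
    ContinuousOn (fun x => kummerArg y x i) s := by
  fin_cases i <;> dsimp [kummerArg] <;> fun_prop (disch := simp +contextual [hy, hs])

lemma continuousOn_kummerLog (h : ∀ x ∈ segment ℝ 0 x₀, KummerAdmissible y x) (i : Fin 8) :
    ContinuousOn (fun x => kummerLog y x i) (segment ℝ 0 x₀) := by
  have ha : ContinuousOn (fun x => log (1 - x)) (segment ℝ 0 x₀) :=
    ContinuousOn.clog (by fun_prop) fun x hx => h x hx 7
  have hb : ContinuousOn (fun x => log (1 - x * y)) (segment ℝ 0 x₀) :=
    ContinuousOn.clog (by fun_prop) fun x hx => h x hx 1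
  have hc : ContinuousOn (fun x => log (1 - x / y)) (segment ℝ 0 x₀) :=
    ContinuousOn.clog (by fun_prop) fun x hx => h x hx 2
  fin_cases i <;> dsimp [kummerLog] <;> fun_prop

lemma hasDerivAt_kummerArg (hy : y ≠ 0) (hx : x ≠ 0) (hx1 : 1 - x ≠ 0) (i : Fin 8) :
    HasDerivAt (fun x => kummerArg y x i) (kummerArg y x i * kummerLogDeriv x i) x := by
  have d := hasDerivAt_id' x
  have d' := d.const_sub 1
  have ha := mul_ne_zero hy hx1
  have ha2 := mul_ne_zero hy (pow_ne_zero 2 hx1)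
  fin_cases i
  · refine ((d.mul_const ((1 - y) ^ 2)).div ((d'.fun_pow 2).const_mul y) ha2).congr_deriv ?_
    dsimp [kummerArg, kummerLogDeriv]; field_simp; ring
  · exact (d.mul_const y).congr_deriv (by dsimp [kummerArg, kummerLogDeriv]; field_simp)
  · exact (d.div_const y).congr_deriv (by dsimp [kummerArg, kummerLogDeriv]; field_simp)
  · refine ((d.mul_const (1 - y)).div (d'.const_mul y) ha).congr_deriv ?_
    dsimp [kummerArg, kummerLogDeriv]; field_simp; ring
  · refine ((d.mul_const (y - 1)).div d' hx1).congr_deriv ?_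
    dsimp [kummerArg, kummerLogDeriv]; field_simp; ring
  · refine ((d'.fun_inv hx1).const_mul (1 - y)).congr_deriv ?_
    dsimp [kummerArg, kummerLogDeriv]; field_simp
  · refine (((d'.const_mul y).fun_inv ha).const_mul (y - 1)).congr_deriv ?_
    dsimp [kummerArg, kummerLogDeriv]; field_simp
  · exact d.congr_deriv (by dsimp [kummerArg, kummerLogDeriv]; field_simp)

lemma polylog_one_kummerArg (hy : y ∈ slitPlane)
    (h : ∀ x ∈ segment ℝ 0 x₀, KummerAdmissible y x) (hx : x ∈ segment ℝ 0 x₀) (i : Fin 8) :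
    polylog 1 (kummerArg y x i) = -kummerLog y x i := by
  have hy0 := slitPlane_ne_zero hy
  rw [polylog_one (h x hx i), neg_inj]
  refine eqOn_of_exp_eqOn (f := fun x => log (1 - kummerArg y x i)) (g := fun x => kummerLog y x i)
    (convex_segment 0 x₀).isPreconnected ?_ (continuousOn_kummerLog h i) (fun x hx => ?_)
    (left_mem_segment ℝ 0 x₀) ?_ hx
  · exact (continuousOn_const.sub (continuousOn_kummerArg hy0 (fun x hx =>
      (h x hx).one_sub_ne_zero) i)).clog fun x hx => h x hx i
  · rw [exp_kummerLog hy0 (h x hx), exp_log (slitPlane_ne_zero (h x hx i))]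
  · have hinv : 1 - (y - 1) / y = y⁻¹ := by field_simp; ring
    fin_cases i <;> simp [kummerArg, kummerLog, hinv, log_inv_of_mem_slitPlane hy]

lemma isLogCurve_kummerArg (hy0 : y ≠ 0) (hy1 : y ≠ 1) (hx₀ : x₀ ≠ 0)
    (h : ∀ x ∈ segment ℝ 0 x₀, KummerAdmissible y x) (i : Fin 8) :
    IsLogCurve 0 x₀ (fun x => kummerArg y x i) fun x => kummerLogDeriv x i where
  continuousOn := continuousOn_kummerArg hy0 (fun x hx => (h x hx).one_sub_ne_zero) i
  mem_cutPlane x hx := h x hx i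
  ne_zero x hx := by
    have ha := (h x (openSegment_subset_segment ℝ _ _ hx)).one_sub_ne_zero
    have hx0 : x ≠ 0 := ne_left_of_mem_openSegment hx₀.symm hx
    have hy1' := sub_ne_zero.2 hy1
    have hy1'' := sub_ne_zero.2 hy1.symm
    fin_cases i <;> simp [kummerArg, ha, hx0, hy0, hy1', hy1'']
  hasDerivAt x hx := hasDerivAt_kummerArg hy0 (ne_left_of_mem_openSegment hx₀.symm hx)
    (h x (openSegment_subset_segment ℝ _ _ hx)).one_sub_ne_zero i

lemma kummerArg_zero_right (hy : y ≠ 0) :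
    kummerArg y 0 = ![0, 0, 0, 0, 0, 1 - y, 1 - y⁻¹, 0] := by
  simp [kummerArg, sub_div, hy]

theorem polylog_two_kummer_six_term (hy : y ∈ slitPlane) (hy1 : y ≠ 1) (hx₀ : x₀ ≠ 0)
    (h : ∀ x ∈ segment ℝ 0 x₀, KummerAdmissible y x) :
    ∑ i, ![1, 1, 1, -2, -2, 0, 0, -2] i * polylog 2 (kummerArg y x₀ i) = 0 := by
  have hy0 := slitPlane_ne_zero hy
  have hsum := sum_polylog_succ_sub (n := 1) (g := 0) (isLogCurve_kummerArg hy0 hy1 hx₀ h)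
    ![1, 1, 1, -2, -2, 0, 0, -2] continuousOn_const fun x hx => by
      refine (hasDerivAt_const x 0).congr_deriv ?_
      simp only [polylog_one_kummerArg hy h (openSegment_subset_segment ℝ _ _ hx)]
      simp only [Fin.sum_univ_eight, kummerLogDeriv, kummerLog, Matrix.cons_val]
      ring
  simpa [kummerArg_zero_right hy0, Fin.sum_univ_eight] using hsum

theorem polylog_two_kummer_five_term (hy : y ∈ slitPlane) (hy1 : y ≠ 1) (hx₀ : x₀ ≠ 0)
    (h : ∀ x ∈ segment ℝ 0 x₀, KummerAdmissible y x) :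
    ∑ i, ![1, 0, 0, -1, -1, -1, -1, 0] i * polylog 2 (kummerArg y x₀ i) = log y ^ 2 / 2 := by
  have hy0 := slitPlane_ne_zero hy
  have hsum := sum_polylog_succ_sub (n := 1) (g := 0) (isLogCurve_kummerArg hy0 hy1 hx₀ h)
    ![1, 0, 0, -1, -1, -1, -1, 0] continuousOn_const fun x hx => by
      refine (hasDerivAt_const x 0).congr_deriv ?_
      simp only [polylog_one_kummerArg hy h (openSegment_subset_segment ℝ _ _ hx)]
      simp only [Fin.sum_univ_eight, kummerLogDeriv, kummerLog, Matrix.cons_val]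
      ring
  have hzero : ∑ i, ![1, 0, 0, -1, -1, -1, -1, 0] i * polylog 2 (kummerArg y 0 i) =
      -(polylog 2 (1 - y) + polylog 2 (1 - y⁻¹)) := by
    simp only [kummerArg_zero_right hy0, Fin.sum_univ_eight, Matrix.cons_val, polylog_zero]
    ring
  rw [hzero, polylog_two_landen hy] at hsum
  linear_combination hsum

/-- The `x`-derivative of the left-hand side is `x⁻¹` times the six-term combination of dilogarithms
plus `2 (1 - x)⁻¹` times the five-term one. -/
theorem polylog_three_spence_kummer (hy : y ∈ slitPlane) (hyn : ‖y‖ ≤ 1) (hy1 : y ≠ 1)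
    (hx₀ : x₀ ≠ 0) (h : ∀ x ∈ segment ℝ 0 x₀, KummerAdmissible y x) :
    ∑ i, ![1, 1, 1, -2, -2, -2, -2, -2] i * polylog 3 (kummerArg y x₀ i)
        - 2 * polylog 3 y + 2 * Li 3 1
      = log y ^ 2 * (log (1 - y) - log (1 - x₀)) - (Real.pi : ℂ) ^ 2 / 3 * log y
        - log y ^ 3 / 3 := by
  have hy0 := slitPlane_ne_zero hy
  have hsum := sum_polylog_succ_sub (n := 2) (g := fun x => -(log y ^ 2 * log (1 - x)))
    (isLogCurve_kummerArg hy0 hy1 hx₀ h) ![1, 1, 1, -2, -2, -2, -2, -2]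
    (continuousOn_const.mul (continuousOn_kummerLog h 7)).neg fun x hx => by
      have hxs := openSegment_subset_segment ℝ _ _ hx
      have hx0 := ne_left_of_mem_openSegment hx₀.symm hx
      have hseg : ∀ w ∈ segment ℝ 0 x, KummerAdmissible y w := fun w hw => h w
        ((convex_segment (0 : ℂ) x₀).segment_subset (left_mem_segment ℝ 0 x₀) hxs hw)
      refine ((((hasDerivAt_id' x).const_sub 1).clog (h x hxs 7)).const_mul _).neg.congr_deriv ?_
      have six := polylog_two_kummer_six_term hy hy1 hx0 hseg
      have five := polylog_two_kummer_five_term hy hy1 hx0 hseg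
      simp only [Fin.sum_univ_eight, kummerLogDeriv, Matrix.cons_val] at six five ⊢
      linear_combination -x⁻¹ * six - 2 * (1 - x)⁻¹ * five
  have hzero : ∑ i, ![1, 1, 1, -2, -2, -2, -2, -2] i * polylog 3 (kummerArg y 0 i) =
      -2 * (polylog 3 (1 - y) + polylog 3 (1 - y⁻¹)) := by
    simp only [kummerArg_zero_right hy0, Fin.sum_univ_eight, Matrix.cons_val, polylog_zero]
    ring
  rw [hzero] at hsum
  simp only [sub_zero, log_one] at hsum
  linear_combination hsum - 2 * polylog_three_landen hyn hy hy1

end SpenceKummer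

section Specialization

variable {s : ℝ} {x : ℂ}

lemma add_mul_I_mem_cutPlane {a b : ℝ} (h : a < 1 ∨ b ≠ 0) : (a + b * I : ℂ) ∈ cutPlane :=
  mem_cutPlane_iff.2 (by simpa using h)

lemma kummerArg_half_neg (hs : 0 ≤ s) (i : Fin 8) :
    kummerArg (1 / 2) (-s) i = (![-s / (2 * (1 + s) ^ 2), -s / 2, -2 * s, -s / (1 + s),
      s / (2 * (1 + s)), 1 / (2 * (1 + s)), -1 / (1 + s), -s] i : ℝ) := by
  have hs1 : (1 + s : ℂ) ≠ 0 := by exact_mod_cast (by positivity : 1 + s ≠ 0)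
  fin_cases i <;> dsimp [kummerArg] <;> push_cast <;> (try rw [sub_neg_eq_add]) <;> field_simp <;>
    ring

lemma kummerArg_one_add_I_div_two_neg (hs : 0 ≤ s) (i : Fin 8) :
    kummerArg ((1 + I) / 2) (-s) i =
      (![s / (2 * (1 + s) ^ 2), -s / 2, -s, 0, s / (2 * (1 + s)), 1 / (2 * (1 + s)), 0, -s] i : ℝ)
      + (![s / (2 * (1 + s) ^ 2), -s / 2, s, s / (1 + s), -s / (2 * (1 + s)), -1 / (2 * (1 + s)),
        1 / (1 + s), 0] i : ℝ) * I := by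
  have hs1 : (1 + s : ℂ) ≠ 0 := by exact_mod_cast (by positivity : 1 + s ≠ 0)
  have hI : (1 + I : ℂ) ≠ 0 := fun h => by simpa using congrArg re h
  fin_cases i <;> dsimp [kummerArg] <;> push_cast <;> (try rw [sub_neg_eq_add]) <;> field_simp <;>
    ring_nf <;> simp only [I_sq] <;> ring

lemma kummerArg_half_mul_one_sub_I (i : Fin 8) :
    kummerArg (1 / 2) (s * (1 - I)) i =
      (![s * (1 - 4 * s + 2 * s ^ 2) / (2 * ((1 - s) ^ 2 + s ^ 2) ^ 2), s / 2, 2 * s,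
        s * (1 - 2 * s) / ((1 - s) ^ 2 + s ^ 2), -s * (1 - 2 * s) / (2 * ((1 - s) ^ 2 + s ^ 2)),
        (1 - s) / (2 * ((1 - s) ^ 2 + s ^ 2)), -(1 - s) / ((1 - s) ^ 2 + s ^ 2), s] i : ℝ)
      + (![s * (2 * s ^ 2 - 1) / (2 * ((1 - s) ^ 2 + s ^ 2) ^ 2), -s / 2, -2 * s,
        -s / ((1 - s) ^ 2 + s ^ 2), s / (2 * ((1 - s) ^ 2 + s ^ 2)),
        -s / (2 * ((1 - s) ^ 2 + s ^ 2)), s / ((1 - s) ^ 2 + s ^ 2), -s] i : ℝ) * I := by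
  have hnorm : ((1 - s) ^ 2 + s ^ 2 : ℂ) = (1 - s * (1 - I)) * (1 - s - s * I) := by
    linear_combination (s ^ 2 : ℂ) * I_sq
  have hN : ((1 - s) ^ 2 + s ^ 2 : ℂ) ≠ 0 := by
    exact_mod_cast (by nlinarith [sq_nonneg (1 - 2 * s)] : 0 < (1 - s) ^ 2 + s ^ 2).ne'
  have hne := left_ne_zero_of_mul (hnorm ▸ hN)
  have hconj := right_ne_zero_of_mul (hnorm ▸ hN)
  fin_cases i <;> dsimp [kummerArg] <;> push_cast <;> (try rw [hnorm]) <;> field_simp <;>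
    ring_nf <;> simp only [I_sq, I_pow_three] <;> ring

lemma exists_mem_Icc_eq_mul_of_mem_segment_zero {z : ℂ} (hx : x ∈ segment ℝ 0 z) :
    ∃ s : ℝ, s ∈ Icc 0 1 ∧ x = s * z := by
  rw [segment_eq_image'] at hx
  obtain ⟨s, hs, rfl⟩ := hx
  exact ⟨s, hs, by simp⟩

lemma kummerAdmissible_half_of_mem_segment_neg_one (hx : x ∈ segment ℝ 0 (-1)) :
    KummerAdmissible (1 / 2) x := by
  obtain ⟨s, ⟨hs, -⟩, rfl⟩ := exists_mem_Icc_eq_mul_of_mem_segment_zero hx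
  intro i
  rw [mul_neg_one, kummerArg_half_neg hs]
  refine mem_cutPlane_iff.2 (Or.inl ?_)
  rw [ofReal_re]
  fin_cases i <;> dsimp <;> (try rw [div_lt_one (by positivity)]) <;> nlinarith

lemma kummerAdmissible_one_add_I_div_two_of_mem_segment_neg_one (hx : x ∈ segment ℝ 0 (-1)) :
    KummerAdmissible ((1 + I) / 2) x := by
  obtain ⟨s, ⟨hs, -⟩, rfl⟩ := exists_mem_Icc_eq_mul_of_mem_segment_zero hx
  intro i
  rw [mul_neg_one, kummerArg_one_add_I_div_two_neg hs]
  refine add_mul_I_mem_cutPlane (Or.inl ?_)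
  fin_cases i <;> dsimp <;> (try rw [div_lt_one (by positivity)]) <;> nlinarith

lemma kummerAdmissible_half_of_mem_segment_one_sub_I (hx : x ∈ segment ℝ 0 (1 - I)) :
    KummerAdmissible (1 / 2) x := by
  obtain ⟨s, ⟨hs, -⟩, rfl⟩ := exists_mem_Icc_eq_mul_of_mem_segment_zero hx
  intro i
  rw [kummerArg_half_mul_one_sub_I]
  have hN : 0 < (1 - s) ^ 2 + s ^ 2 := by nlinarith [sq_nonneg (1 - 2 * s)]
  apply add_mul_I_mem_cutPlane
  rcases hs.eq_or_lt with rfl | hs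
  · left
    fin_cases i <;> norm_num
  rcases eq_or_ne i 0 with rfl | hi
  · -- When the imaginary part vanishes, `2 * s ^ 2 = 1` makes the real part negative.
    rcases eq_or_ne (2 * s ^ 2 - 1) 0 with h | h
    · left
      dsimp
      rw [div_lt_one (by positivity)]
      nlinarith
    · right
      exact div_ne_zero (mul_ne_zero hs.ne' h) (by positivity)
  · right
    fin_cases i <;> first | exact absurd rfl hi | simp [hs.ne', hN.ne']

end Specialization

section Evaluation

lemma kummerArg_half_neg_one :
    kummerArg (1 / 2) (-1) = ![-1 / 8, -1 / 2, -2, -1 / 2, 1 / 4, 1 / 4, -1 / 2, -1] := by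
  funext i
  have h := kummerArg_half_neg zero_le_one i
  rw [ofReal_one] at h
  rw [h]
  fin_cases i <;> norm_num

lemma kummerArg_one_add_I_div_two_neg_one :
    kummerArg ((1 + I) / 2) (-1) = ![(1 + I) / 8, -((1 + I) / 2), -1 + I, I / 2, (1 - I) / 4,
      (1 - I) / 4, I / 2, -1] := by
  funext i
  have h := kummerArg_one_add_I_div_two_neg zero_le_one i
  rw [ofReal_one] at h
  rw [h]
  fin_cases i <;> norm_num <;> ring

lemma kummerArg_half_one_sub_I :
    kummerArg (1 / 2) (1 - I) = ![-((1 - I) / 2), (1 - I) / 2, 2 - 2 * I, -1 - I, (1 + I) / 2,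
      -I / 2, I, 1 - I] := by
  funext i
  have h := kummerArg_half_mul_one_sub_I (s := 1) i
  rw [ofReal_one, one_mul] at h
  rw [h]
  fin_cases i <;> norm_num <;> ring

end Evaluation

section Logarithms

lemma norm_one_add_I_div_lt_one (k : ℕ) [k.AtLeastTwo] : ‖(1 + I : ℂ) / ofNat(k)‖ < 1 := by
  have hsq : ‖(1 + I : ℂ)‖ ^ 2 = 2 := by
    rw [← normSq_eq_norm_sq, normSq_apply]
    norm_num
  have hk : (2 : ℝ) ≤ ofNat(k) := by
    rw [← Nat.cast_ofNat (n := k)]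
    exact Nat.ofNat_le_cast.2 Nat.AtLeastTwo.prop
  rw [norm_div, RCLike.norm_ofNat, div_lt_one (by linarith)]
  nlinarith [norm_nonneg (1 + I : ℂ)]

lemma conj_one_add_I_div (k : ℕ) [k.AtLeastTwo] :
    (starRingEnd ℂ) ((1 + I) / ofNat(k)) = (1 - I) / ofNat(k) := by
  simp only [map_div₀, map_add, map_one, conj_I, map_ofNat, sub_eq_add_neg]

lemma norm_one_sub_I_div_lt_one (k : ℕ) [k.AtLeastTwo] : ‖(1 - I : ℂ) / ofNat(k)‖ < 1 := by
  rw [← conj_one_add_I_div, norm_conj]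
  exact norm_one_add_I_div_lt_one k

lemma one_add_I_ne_zero : (1 + I : ℂ) ≠ 0 := fun h => by simpa using congrArg re h

lemma one_sub_I_ne_zero : (1 - I : ℂ) ≠ 0 := fun h => by simpa using congrArg re h

lemma inv_one_add_I : (1 + I : ℂ)⁻¹ = (1 - I) / 2 := by
  rw [inv_eq_iff_eq_inv, inv_div, eq_div_iff one_sub_I_ne_zero]
  linear_combination -I_sq

lemma inv_one_sub_I : (1 - I : ℂ)⁻¹ = (1 + I) / 2 := by
  rw [inv_eq_iff_eq_inv, inv_div, eq_div_iff one_add_I_ne_zero]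
  linear_combination -I_sq

lemma one_add_I_eq_mul_exp : (1 + I : ℂ) = (√2 : ℝ) * exp ((Real.pi / 4 : ℝ) * I) := by
  rw [exp_mul_I, ← ofReal_cos, ← ofReal_sin, Real.cos_pi_div_four, Real.sin_pi_div_four]
  have h : ((√2 : ℝ) : ℂ) ^ 2 = 2 := by
    rw [← ofReal_pow, Real.sq_sqrt (by norm_num)]
    norm_num
  push_cast
  linear_combination -(1 + I) / 2 * h

lemma log_sqrt_two_mul_exp {θ : ℝ} (h₁ : -Real.pi < θ) (h₂ : θ ≤ Real.pi) :
    log ((√2 : ℝ) * exp (θ * I)) = Real.log 2 / 2 + θ * I := by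
  rw [log_ofReal_mul (by positivity) (exp_ne_zero _), log_exp (by simpa using h₁)
    (by simpa using h₂), Real.log_sqrt (by norm_num)]
  push_cast
  ring

lemma log_one_add_I : log (1 + I) = Real.log 2 / 2 + Real.pi / 4 * I := by
  have hπ := Real.pi_pos
  rw [one_add_I_eq_mul_exp, log_sqrt_two_mul_exp (by linarith) (by linarith)]
  push_cast
  ring

lemma log_neg_one_add_I : log (-1 + I) = Real.log 2 / 2 + 3 * Real.pi / 4 * I := by
  have hπ := Real.pi_pos
  have h : (-1 + I : ℂ) = (√2 : ℝ) * exp ((3 * Real.pi / 4 : ℝ) * I) := by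
    rw [show ((3 * Real.pi / 4 : ℝ) : ℂ) * I = (Real.pi / 4 : ℝ) * I + Real.pi / 2 * I by
      push_cast; ring, exp_add, exp_pi_div_two_mul_I, ← mul_assoc, ← one_add_I_eq_mul_exp]
    linear_combination -I_sq
  rw [h, log_sqrt_two_mul_exp (by linarith) (by linarith)]
  push_cast
  ring

lemma log_one_sub_I : log (1 - I) = Real.log 2 / 2 - Real.pi / 4 * I := by
  have h : (1 - I : ℂ) = (starRingEnd ℂ) (1 + I) := by simp [sub_eq_add_neg]
  rw [h, log_conj _ (slitPlane_arg_ne_pi (Or.inl (by simp))), log_one_add_I]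
  simp only [map_add, map_mul, map_div₀, conj_ofReal, conj_I, map_ofNat]
  ring

lemma log_div_two {z : ℂ} (hz : z ≠ 0) : log (z / 2) = log z - Real.log 2 := by
  have h : z / 2 = ((2⁻¹ : ℝ) : ℂ) * z := by
    push_cast
    ring
  rw [h, log_ofReal_mul (by norm_num) hz, Real.log_inv]
  push_cast
  ring

lemma log_half : log (1 / 2) = -Real.log 2 := by
  rw [log_div_two one_ne_zero, log_one, zero_sub]

lemma log_neg_two_add_two_mul_I :
    log (-2 + 2 * I) = 3 * Real.log 2 / 2 + 3 * Real.pi / 4 * I := by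
  have h : (-2 + 2 * I : ℂ) = (2 : ℝ) * (-1 + I) := by
    push_cast
    ring
  rw [h, log_ofReal_mul (by norm_num) (fun h => by simpa using congrArg im h),
    log_neg_one_add_I]
  ring

end Logarithms

section SpecialValues

lemma polylog_three_eq_Li {z : ℂ} (hz : ‖z‖ < 1) : polylog 3 z = Li 3 z :=
  polylog_eq_Li (by norm_num) hz.le (by rintro rfl; simp at hz)

lemma polylog_three_eq_Li_inv {z : ℂ} (hz : -z ∈ slitPlane) (h : 1 ≤ ‖z‖) :
    polylog 3 z = Li 3 z⁻¹ - (Real.pi : ℂ) ^ 2 / 6 * log (-z) - log (-z) ^ 3 / 6 := by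
  have hinv := polylog_three_inversion hz
  have hne : z⁻¹ ≠ 1 := by
    rw [inv_ne_one]
    rintro rfl
    exact absurd hz (by norm_num [mem_slitPlane_iff])
  rw [neg_neg, inv_neg, neg_neg,
    polylog_eq_Li (by norm_num) (by rw [norm_inv]; exact inv_le_one_of_one_le₀ h) hne] at hinv
  linear_combination hinv

lemma Li_one_sub_I_div (n k : ℕ) [k.AtLeastTwo] :
    Li n ((1 - I) / ofNat(k)) = (starRingEnd ℂ) (Li n ((1 + I) / ofNat(k))) := by
  rw [← Li_conj, conj_one_add_I_div]

lemma polylog_three_one_add_I_div (k : ℕ) [k.AtLeastTwo] :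
    polylog 3 ((1 + I) / ofNat(k)) = Li 3 ((1 + I) / ofNat(k)) :=
  polylog_three_eq_Li (norm_one_add_I_div_lt_one k)

lemma polylog_three_one_sub_I_div (k : ℕ) [k.AtLeastTwo] :
    polylog 3 ((1 - I) / ofNat(k)) = (starRingEnd ℂ) (Li 3 ((1 + I) / ofNat(k))) := by
  rw [← Li_one_sub_I_div, polylog_three_eq_Li (norm_one_sub_I_div_lt_one k)]

lemma Li_neg_I_div_two (n : ℕ) : Li n (-I / 2) = (starRingEnd ℂ) (Li n (I / 2)) := by
  rw [← Li_conj, map_div₀, conj_I, map_ofNat]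

lemma Li_neg_I (n : ℕ) : Li n (-I) = (starRingEnd ℂ) (Li n I) := by
  rw [← Li_conj, conj_I]

lemma Li_three_neg_one : Li 3 (-1) = -3 / 4 * Li 3 1 := by
  linear_combination Li_neg_one (n := 3) (by norm_num) / 8

lemma Li_three_I_add_conj : Li 3 I + (starRingEnd ℂ) (Li 3 I) = -3 / 16 * Li 3 1 := by
  have h := Li_sq (n := 3) (z := I) (by norm_num) (by simp)
  rw [I_sq, Li_neg_I, Li_three_neg_one] at h
  linear_combination -h / 8

lemma Li_three_neg_one_add_I_div_two :
    Li 3 (-((1 + I) / 2)) = Li 3 (I / 2) / 4 - Li 3 ((1 + I) / 2) := by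
  have h := Li_sq (n := 3) (by norm_num) (norm_one_add_I_div_lt_one 2).le
  rw [show ((1 + I) / 2) ^ 2 = I / 2 by linear_combination I_sq / 4] at h
  linear_combination -h / 8

lemma Li_three_neg_one_sub_I_div_two :
    Li 3 (-((1 - I) / 2))
      = (starRingEnd ℂ) (Li 3 (I / 2)) / 4 - (starRingEnd ℂ) (Li 3 ((1 + I) / 2)) := by
  rw [← conj_one_add_I_div, ← map_neg, Li_conj, Li_three_neg_one_add_I_div_two, map_sub, map_div₀,
    map_ofNat]

lemma Li_three_quarter : Li 3 (1 / 4) = 4 * (Li 3 (1 / 2) + Li 3 (-1 / 2)) := by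
  have h := Li_sq (n := 3) (z := 1 / 2) (by norm_num) (by norm_num)
  rw [show (1 / 2 : ℂ) ^ 2 = 1 / 4 by norm_num, ← neg_div] at h
  linear_combination h / 2

lemma Li_three_I_sub_conj : Li 3 I - (starRingEnd ℂ) (Li 3 I) = (Real.pi : ℂ) ^ 3 / 16 * I := by
  have h := polylog_three_eq_Li_inv (z := I) (Or.inr (by simp)) (by simp)
  rw [inv_I, polylog_eq_Li (by norm_num) (by simp) (fun h => by simpa using congrArg re h),
    Li_neg_I, log_neg_I] at h
  linear_combination h + (Real.pi : ℂ) ^ 3 / 48 * I_pow_three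

lemma Li_three_half : 2 * Li 3 (1 / 2)
    = 7 / 4 * Li 3 1 + (Real.log 2 : ℂ) ^ 3 / 3 - (Real.pi : ℂ) ^ 2 / 6 * Real.log 2 := by
  have h := polylog_three_landen (z := 1 / 2) (by norm_num) (Or.inl (by norm_num)) (by norm_num)
  rw [show (1 : ℂ) - 1 / 2 = 1 / 2 by norm_num, show (1 : ℂ) - (1 / 2)⁻¹ = -1 by norm_num,
    polylog_three_eq_Li (by norm_num),
    polylog_eq_Li (by norm_num) (by simp) (by norm_num), Li_three_neg_one, log_half] at h
  linear_combination h

lemma one_add_I_div_two_mem_slitPlane : (1 + I : ℂ) / 2 ∈ slitPlane := Or.inl (by simp)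

lemma one_add_I_div_two_ne_one : (1 + I : ℂ) / 2 ≠ 1 := fun h => by simpa using congrArg im h

lemma log_one_add_I_div_two :
    log ((1 + I) / 2) = -(Real.log 2 : ℂ) / 2 + Real.pi / 4 * I := by
  rw [log_div_two one_add_I_ne_zero, log_one_add_I]
  ring

lemma log_one_sub_I_div_two :
    log ((1 - I) / 2) = -(Real.log 2 : ℂ) / 2 - Real.pi / 4 * I := by
  rw [log_div_two one_sub_I_ne_zero, log_one_sub_I]
  ring

lemma one_sub_one_add_I_div_two : (1 - (1 + I) / 2 : ℂ) = (1 - I) / 2 := by ring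

lemma Li_three_one_add_I_div_two_add_conj :
    Li 3 ((1 + I) / 2) + (starRingEnd ℂ) (Li 3 ((1 + I) / 2)) + Li 3 I = Li 3 1
      + (Real.log 2 : ℂ) ^ 3 / 24 - 5 / 96 * (Real.pi : ℂ) ^ 2 * Real.log 2
      + (Real.pi : ℂ) ^ 3 / 32 * I := by
  have h := polylog_three_landen (norm_one_add_I_div_lt_one 2).le one_add_I_div_two_mem_slitPlane
    one_add_I_div_two_ne_one
  rw [one_sub_one_add_I_div_two, ← inv_one_sub_I, inv_inv, inv_one_sub_I, sub_sub_cancel,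
    polylog_three_one_add_I_div, polylog_three_one_sub_I_div,
    polylog_eq_Li (by norm_num) (by simp) (fun h => by simpa using congrArg re h),
    log_one_add_I_div_two, log_one_sub_I_div_two] at h
  rw [h]
  ring_nf
  simp only [I_sq, I_pow_three]
  ring

lemma Li_three_neg_eighth :
    Li 3 (-1 / 8) - 18 * Li 3 (-1 / 2) = 49 / 4 * Li 3 1 + 3 / 2 * (Real.log 2 : ℂ) ^ 3
      - (Real.pi : ℂ) ^ 2 * Real.log 2 := by
  have h := polylog_three_spence_kummer (y := 1 / 2) (x₀ := -1) (Or.inl (by norm_num))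
    (by norm_num) (by norm_num) (by norm_num)
    (fun x hx => kummerAdmissible_half_of_mem_segment_neg_one hx)
  have h2 := polylog_three_eq_Li_inv (z := -2) (Or.inl (by norm_num)) (by norm_num)
  rw [neg_neg, ← ofReal_ofNat, ← ofReal_log zero_le_two, ofReal_ofNat,
    show (-2 : ℂ)⁻¹ = -1 / 2 by norm_num] at h2
  rw [kummerArg_half_neg_one] at h
  simp only [Fin.sum_univ_eight, Matrix.cons_val] at h
  rw [h2, polylog_three_eq_Li (z := -1 / 8) (by norm_num),
    polylog_three_eq_Li (z := -1 / 2) (by norm_num),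
    polylog_three_eq_Li (z := 1 / 4) (by norm_num),
    polylog_three_eq_Li (z := 1 / 2) (by norm_num),
    polylog_eq_Li (z := -1) (by norm_num) (by simp) (by norm_num), Li_three_quarter,
    Li_three_neg_one, log_half, show (1 : ℂ) - 1 / 2 = 1 / 2 by norm_num, log_half,
    show (1 - -1 : ℂ) = (2 : ℝ) by norm_num, ← ofReal_log zero_le_two] at h
  linear_combination h + 9 * Li_three_half

lemma Li_three_one_add_I_div_eight :
    Li 3 ((1 + I) / 8) - 7 / 2 * Li 3 (I / 2) - 4 * (starRingEnd ℂ) (Li 3 ((1 + I) / 4))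
      - 4 * Li 3 ((1 + I) / 2) + 7 / 2 * Li 3 1
    = -5 / 16 * (Real.log 2 : ℂ) ^ 3 + 15 / 64 * (Real.pi : ℂ) ^ 2 * Real.log 2
      + (7 / 32 * Real.pi * (Real.log 2 : ℂ) ^ 2 - 13 / 128 * (Real.pi : ℂ) ^ 3) * I := by
  have h := polylog_three_spence_kummer (x₀ := -1) one_add_I_div_two_mem_slitPlane
    (norm_one_add_I_div_lt_one 2).le one_add_I_div_two_ne_one (by norm_num)
    (fun x hx => kummerAdmissible_one_add_I_div_two_of_mem_segment_neg_one hx)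
  have hinv := polylog_three_eq_Li_inv (z := -1 + I) (Or.inl (by simp))
    (by simpa using abs_re_le_norm (-1 + I))
  rw [show -(-1 + I) = 1 - I by ring, show (-1 + I : ℂ) = -(1 - I) by ring, inv_neg,
    inv_one_sub_I, log_one_sub_I, Li_three_neg_one_add_I_div_two] at hinv
  rw [kummerArg_one_add_I_div_two_neg_one] at h
  simp only [Fin.sum_univ_eight, Matrix.cons_val] at h
  rw [show (-1 + I : ℂ) = -(1 - I) by ring, hinv,
    polylog_three_one_add_I_div, polylog_three_one_add_I_div, polylog_three_one_sub_I_div,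
    polylog_three_eq_Li (z := -((1 + I) / 2))
      (by rw [norm_neg]; exact norm_one_add_I_div_lt_one 2),
    polylog_three_eq_Li (z := I / 2) (by norm_num),
    polylog_eq_Li (z := -1) (by norm_num) (by simp) (by norm_num), Li_three_neg_one,
    Li_three_neg_one_add_I_div_two, log_one_add_I_div_two,
    one_sub_one_add_I_div_two, log_one_sub_I_div_two,
    show (1 - -1 : ℂ) = (2 : ℝ) by norm_num, ← ofReal_log zero_le_two] at h
  linear_combination h + 1 / 64 * (Real.pi : ℂ) ^ 2 * Real.log 2 * I_sq
    - 3 / 128 * (Real.pi : ℂ) ^ 3 * I_pow_three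

lemma Li_three_one_add_I_div_four :
    Li 3 ((1 + I) / 4) - 9 / 4 * (starRingEnd ℂ) (Li 3 (I / 2))
      + 2 * (starRingEnd ℂ) (Li 3 ((1 + I) / 2)) - 4 * Li 3 ((1 + I) / 2) - 2 * Li 3 I
      - 2 * Li 3 (1 / 2) + 2 * Li 3 1
    = -3 / 16 * (Real.log 2 : ℂ) ^ 3 + 9 / 64 * (Real.pi : ℂ) ^ 2 * Real.log 2
      + (3 / 32 * Real.pi * (Real.log 2 : ℂ) ^ 2 - 17 / 128 * (Real.pi : ℂ) ^ 3) * I := by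
  have h := polylog_three_spence_kummer (y := 1 / 2) (Or.inl (by norm_num)) (by norm_num)
    (by norm_num) one_sub_I_ne_zero (fun x hx => kummerAdmissible_half_of_mem_segment_one_sub_I hx)
  have hinv₁ := polylog_three_eq_Li_inv (z := 2 - 2 * I) (Or.inr (by simp))
    (one_le_two.trans (by simpa using abs_re_le_norm (2 - 2 * I)))
  have hinv₂ := polylog_three_eq_Li_inv (z := -1 - I) (Or.inl (by simp))
    (by simpa using abs_re_le_norm (-1 - I))
  have hinv₃ := polylog_three_eq_Li_inv (z := 1 - I) (Or.inr (by simp))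
    (by simpa using abs_re_le_norm (1 - I))
  rw [show -(2 - 2 * I) = -2 + 2 * I by ring, log_neg_two_add_two_mul_I,
    show (2 - 2 * I : ℂ) = 2 * (1 - I) by ring, mul_inv, inv_one_sub_I,
    show (2 : ℂ)⁻¹ * ((1 + I) / 2) = (1 + I) / 4 by ring] at hinv₁
  rw [show (-1 - I : ℂ) = -(1 + I) by ring, neg_neg, log_one_add_I, inv_neg, inv_one_add_I,
    Li_three_neg_one_sub_I_div_two] at hinv₂
  rw [neg_sub, show I - 1 = -1 + I by ring, log_neg_one_add_I, inv_one_sub_I] at hinv₃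
  rw [kummerArg_half_one_sub_I] at h
  simp only [Fin.sum_univ_eight, Matrix.cons_val] at h
  rw [show (2 - 2 * I : ℂ) = 2 * (1 - I) by ring, hinv₁,
    show (-1 - I : ℂ) = -(1 + I) by ring, hinv₂, hinv₃, sub_sub_cancel, log_I,
    show (1 : ℂ) - 1 / 2 = 1 / 2 by norm_num, log_half,
    polylog_three_eq_Li (z := -((1 - I) / 2))
      (by rw [norm_neg]; exact norm_one_sub_I_div_lt_one 2),
    polylog_three_one_add_I_div, polylog_three_one_sub_I_div,
    polylog_three_eq_Li (z := -I / 2) (by norm_num),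
    polylog_three_eq_Li (z := 1 / 2) (by norm_num),
    polylog_eq_Li (z := I) (by norm_num) (by simp) (fun h => by simpa using congrArg re h),
    Li_neg_I_div_two, Li_three_neg_one_sub_I_div_two] at h
  linear_combination h + 7 / 64 * (Real.pi : ℂ) ^ 2 * Real.log 2 * I_sq
    - 29 / 384 * (Real.pi : ℂ) ^ 3 * I_pow_three

end SpecialValues

section PeriodicSeries

variable {n p : ℕ}

lemma summable_S_term (hn : 2 ≤ n) (p : ℕ) (a : Fin 8 → ℤ) :
    Summable fun j : ℕ => (a ⟨j % 8, Nat.mod_lt j (by norm_num)⟩ : ℝ) /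
      (2 ^ ((p * (j + 1) + p) / 2) * ((j : ℝ) + 1) ^ n) := by
  refine Summable.of_norm_bounded
    ((summable_one_div_succ_pow hn).mul_left (∑ i, |(a i : ℝ)|)) fun j => ?_
  rw [norm_div, Real.norm_eq_abs, Real.norm_of_nonneg (by positivity), ← mul_div_assoc, mul_one]
  gcongr
  · exact Finset.single_le_sum (f := fun i => |(a i : ℝ)|) (fun i _ => abs_nonneg _)
      (Finset.mem_univ _)
  · exact le_mul_of_one_le_left (by positivity) (one_le_pow₀ (by norm_num))

lemma S_eq_sum (hn : 2 ≤ n) (p : ℕ) (a : Fin 8 → ℤ) :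
    S n p a = ∑ i, a i * S n p (Pi.single i 1) := by
  simp only [S, ← tsum_mul_left]
  rw [← Summable.tsum_finsetSum fun i _ => (summable_S_term hn p (Pi.single i 1)).mul_left _]
  refine tsum_congr fun j => ?_
  rw [Finset.sum_eq_single ⟨j % 8, Nat.mod_lt j (by norm_num)⟩]
  · simp [div_eq_mul_inv]
  · intro i _ hi
    simp [hi.symm]
  · simp

lemma map_Li_eq_S (hn : 2 ≤ n) {z : ℂ} (hz : ‖z‖ ≤ 1) (f : ℂ →L[ℝ] ℝ) {a : Fin 8 → ℤ} {c : ℝ}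
    {d : ℕ} (hd : d ∣ 8) (ha : ∀ i : Fin 8, ¬ d ∣ (i : ℕ) + 1 → a i = 0)
    (hf : ∀ k, f (z ^ (k + 1)) * 2 ^ ((p * (d * (k + 1)) + p) / 2)
      = c * a ⟨(d * (k + 1) - 1) % 8, Nat.mod_lt _ (by norm_num)⟩) :
    f (Li n z) = d ^ n * c * S n p a := by
  have hd0 : 0 < d := Nat.pos_of_dvd_of_pos hd (by norm_num)
  have hsucc (k : ℕ) : d * (k + 1) - 1 + 1 = d * (k + 1) :=
    Nat.sub_add_cancel (Nat.mul_pos hd0 k.succ_pos)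
  have hinj : Function.Injective fun k => d * (k + 1) - 1 := fun k l h => by
    have h' : d * (k + 1) = d * (l + 1) := by rw [← hsucc k, ← hsucc l]; exact congrArg (· + 1) h
    simpa using Nat.eq_of_mul_eq_mul_left hd0 h'
  have hS : S n p a = ∑' k, (a ⟨(d * (k + 1) - 1) % 8, Nat.mod_lt _ (by norm_num)⟩ : ℝ) /
      (2 ^ ((p * (d * (k + 1)) + p) / 2) * (d * ((k : ℝ) + 1)) ^ n) := by
    rw [S, ← hinj.tsum_eq]
    · refine tsum_congr fun k => ?_
      have hcast : ((d * (k + 1) - 1 : ℕ) : ℝ) + 1 = d * (k + 1) := by exact_mod_cast hsucc k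
      rw [hcast, hsucc]
    · refine Function.support_subset_iff'.2 fun j hj => ?_
      have hdvd : ¬ d ∣ j % 8 + 1 := fun h => hj <| by
        obtain ⟨k, hk⟩ : d ∣ j + 1 := by
          rw [← Nat.div_add_mod j 8, add_assoc]
          exact dvd_add (hd.mul_right _) h
        obtain ⟨l, rfl⟩ := Nat.exists_eq_succ_of_ne_zero (by rintro rfl; simp at hk : k ≠ 0)
        exact ⟨l, by simp only; rw [← Nat.succ_eq_add_one l, ← hk, Nat.add_sub_cancel]⟩
      rw [ha _ hdvd, Int.cast_zero, zero_div]
  rw [Li, f.map_tsum (summable_Li hn hz), hS, ← tsum_mul_left]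
  refine tsum_congr fun k => ?_
  have hterm : z ^ (k + 1) / ((k : ℂ) + 1) ^ n = (1 / ((k : ℝ) + 1) ^ n) • z ^ (k + 1) := by
    rw [real_smul]
    push_cast
    ring
  rw [hterm, map_smul, smul_eq_mul, eq_div_of_mul_eq (by positivity) (hf k), mul_pow]
  field_simp

lemma one_add_I_pow_succ (k : ℕ) :
    (1 + I) ^ (k + 1) = 2 ^ ((k + 1) / 2) *
      ((![1, 0, -1, -1, -1, 0, 1, 1] : Fin 8 → ℤ) ⟨k % 8, Nat.mod_lt _ (by norm_num)⟩
      + (![1, 1, 1, 0, -1, -1, -1, 0] : Fin 8 → ℤ) ⟨k % 8, Nat.mod_lt _ (by norm_num)⟩ * I) := by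
  have h2 : (1 + I) ^ 2 = 2 * I := by linear_combination I_sq
  have h8 : (1 + I) ^ 8 = 2 ^ 4 := by
    rw [show 8 = 2 * 4 from rfl, pow_mul, h2, mul_pow, I_pow_four, mul_one]
  obtain ⟨q, r, rfl⟩ : ∃ q : ℕ, ∃ r : Fin 8, k = 8 * q + r :=
    ⟨k / 8, ⟨k % 8, Nat.mod_lt _ (by norm_num)⟩, (Nat.div_add_mod k 8).symm⟩
  have hr : (⟨(8 * q + r) % 8, Nat.mod_lt _ (by norm_num)⟩ : Fin 8) = r := by
    ext
    simp only
    lia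
  rw [hr, show (8 * q + r + 1) / 2 = 4 * q + (r + 1) / 2 by lia, add_assoc, pow_add, pow_mul, h8,
    ← pow_mul, pow_add (2 : ℂ), mul_assoc]
  congr 1
  fin_cases r <;> norm_num [Complex.ext_iff, pow_succ]

lemma map_Li_one_add_I_div_two_pow_eq_S (hn : 2 ≤ n) (j : ℕ) (f : ℂ →L[ℝ] ℝ) {a : Fin 8 → ℤ}
    (hf : ∀ k, f ((1 + I) ^ (k + 1))
      = 2 ^ ((k + 1) / 2) * a ⟨k % 8, Nat.mod_lt _ (by norm_num)⟩) :
    f (Li n ((1 + I) / 2 ^ (j + 1))) = 2 ^ j * S n (2 * j + 1) a := by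
  have hnorm : ‖(1 + I) / 2 ^ (j + 1)‖ ≤ 1 := by
    have h2 := norm_add_le 1 I
    rw [norm_div, norm_pow, norm_ofNat, div_le_one (by positivity)]
    have h : (2 : ℝ) ≤ 2 ^ (j + 1) := le_self_pow₀ one_le_two j.succ_ne_zero
    simp only [norm_one, norm_I] at h2
    linarith
  have h := map_Li_eq_S (p := 2 * j + 1) hn hnorm f (a := a) (c := 2 ^ j) (one_dvd 8)
    (fun i hi => absurd (one_dvd _) hi) fun k => ?_
  · simpa only [Nat.cast_one, one_pow, one_mul] using h
  have hsmul : ((1 + I) / 2 ^ (j + 1)) ^ (k + 1)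
      = (1 / 2 ^ ((j + 1) * (k + 1)) : ℝ) • (1 + I) ^ (k + 1) := by
    rw [real_smul, div_pow, ← pow_mul]
    push_cast
    ring
  have hexp : (k + 1) / 2 + ((2 * j + 1) * (1 * (k + 1)) + (2 * j + 1)) / 2
      = (j + 1) * (k + 1) + j := by
    rw [show (2 * j + 1) * (1 * (k + 1)) + (2 * j + 1) = k + 2 + 2 * (j * (k + 2)) by ring,
      Nat.add_mul_div_left _ _ two_pos]
    have : (k + 1) / 2 + (k + 2) / 2 = k + 1 := by lia
    linear_combination this
  rw [hsmul, map_smul, hf, smul_eq_mul]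
  simp only [one_mul, Nat.add_sub_cancel]
  rw [one_mul] at hexp
  rw [mul_assoc, mul_right_comm, ← pow_add, hexp, pow_add]
  field_simp

lemma re_Li_one_add_I_div_two_pow (hn : 2 ≤ n) (j : ℕ) :
    (Li n ((1 + I) / 2 ^ (j + 1))).re = 2 ^ j * S n (2 * j + 1) ![1, 0, -1, -1, -1, 0, 1, 1] :=
  map_Li_one_add_I_div_two_pow_eq_S hn j reCLM fun k => by
    rw [one_add_I_pow_succ, ← ofReal_ofNat, ← ofReal_pow]
    simp only [reCLM_apply, re_ofReal_mul]
    simp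

lemma im_Li_one_add_I_div_two_pow (hn : 2 ≤ n) (j : ℕ) :
    (Li n ((1 + I) / 2 ^ (j + 1))).im = 2 ^ j * S n (2 * j + 1) ![1, 1, 1, 0, -1, -1, -1, 0] :=
  map_Li_one_add_I_div_two_pow_eq_S hn j imCLM fun k => by
    rw [one_add_I_pow_succ, ← ofReal_ofNat, ← ofReal_pow]
    simp only [imCLM_apply, im_ofReal_mul]
    simp

lemma map_Li_div_two_pow_eq_S (hn : 2 ≤ n) (p : ℕ) {ε : ℂ} (hε : ε ^ 4 = 1) (f : ℂ →L[ℝ] ℝ)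
    {a : Fin 8 → ℤ} (ha : ∀ i : Fin 8, ¬ 2 ∣ (i : ℕ) + 1 → a i = 0)
    (hf : ∀ r : Fin 4, f (ε ^ ((r : ℕ) + 1)) = a ⟨2 * r + 1, by lia⟩) :
    f (Li n (ε / 2 ^ p)) = 2 ^ n * 2 ^ (p / 2) * S n p a := by
  have hnorm : ‖ε / 2 ^ p‖ ≤ 1 := by
    rw [norm_div, norm_eq_one_of_pow_eq_one hε four_ne_zero, norm_pow, norm_ofNat]
    exact div_le_one_of_le₀ (one_le_pow₀ one_le_two) (by positivity)
  refine map_Li_eq_S hn hnorm f (by norm_num) ha fun k => ?_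
  have hsmul : (ε / 2 ^ p) ^ (k + 1) = (1 / 2 ^ (p * (k + 1)) : ℝ) • ε ^ (k + 1) := by
    rw [real_smul, div_pow, ← pow_mul]
    push_cast
    ring
  have hfk : f (ε ^ (k + 1)) = a ⟨(2 * (k + 1) - 1) % 8, Nat.mod_lt _ (by norm_num)⟩ := by
    have h := hf ⟨k % 4, Nat.mod_lt _ (by norm_num)⟩
    have hk : ε ^ (k + 1) = ε ^ (k % 4 + 1) := by
      conv_lhs => rw [← Nat.div_add_mod k 4, add_assoc, pow_add, pow_mul, hε, one_pow, one_mul]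
    rw [hk, h]
    congr 3
    lia
  rw [hsmul, map_smul, hfk, smul_eq_mul, show p * (2 * (k + 1)) + p = p + 2 * (p * (k + 1)) by ring,
    Nat.add_mul_div_left _ _ two_pos, pow_add]
  field_simp

lemma re_Li_one_div_two_pow (hn : 2 ≤ n) (p : ℕ) :
    (Li n (1 / 2 ^ p)).re = 2 ^ n * 2 ^ (p / 2) * S n p ![0, 1, 0, 1, 0, 1, 0, 1] :=
  map_Li_div_two_pow_eq_S hn p (one_pow 4) reCLM (by decide) fun r => by
    fin_cases r <;> simp

lemma re_Li_neg_one_div_two_pow (hn : 2 ≤ n) (p : ℕ) :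
    (Li n (-1 / 2 ^ p)).re = 2 ^ n * 2 ^ (p / 2) * S n p ![0, -1, 0, 1, 0, -1, 0, 1] :=
  map_Li_div_two_pow_eq_S hn p (by norm_num) reCLM (by decide) fun r => by
    fin_cases r <;> norm_num [pow_succ]

lemma re_Li_I_div_two_pow (hn : 2 ≤ n) (p : ℕ) :
    (Li n (I / 2 ^ p)).re = 2 ^ n * 2 ^ (p / 2) * S n p ![0, 0, 0, -1, 0, 0, 0, 1] :=
  map_Li_div_two_pow_eq_S hn p I_pow_four reCLM (by decide) fun r => by
    fin_cases r <;> simp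

lemma im_Li_I_div_two_pow (hn : 2 ≤ n) (p : ℕ) :
    (Li n (I / 2 ^ p)).im = 2 ^ n * 2 ^ (p / 2) * S n p ![0, 1, 0, 0, 0, -1, 0, 0] :=
  map_Li_div_two_pow_eq_S hn p I_pow_four imCLM (by decide) fun r => by
    fin_cases r <;> simp

end PeriodicSeries

section LambdaBeta

lemma Li_sub_Li_neg {n : ℕ} (hn : 2 ≤ n) {z : ℂ} (hz : ‖z‖ ≤ 1) :
    Li n z - Li n (-z) = 2 * ∑' k : ℕ, z ^ (2 * k + 1) / (2 * (k : ℂ) + 1) ^ n := by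
  set f : ℕ → ℂ := fun k =>
    z ^ (k + 1) / ((k : ℂ) + 1) ^ n - (-z) ^ (k + 1) / ((k : ℂ) + 1) ^ n with hf
  have hsum : Li n z - Li n (-z) = ∑' k, f k :=
    ((summable_Li hn hz).tsum_sub (summable_Li hn (by simpa using hz))).symm
  have hsupp : Function.support f ⊆ range fun k => 2 * k := by
    refine Function.support_subset_iff'.2 fun k hk => ?_
    have hk' : Even (k + 1) := by
      rw [← Nat.not_odd_iff_even]
      rintro ⟨m, hm⟩
      exact hk ⟨m, by simp only; lia⟩
    simp only [hf, hk'.neg_pow, sub_self]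
  have hinj : Function.Injective fun k => 2 * k := fun a b h => by simpa using h
  rw [hsum, ← hinj.tsum_eq hsupp, ← tsum_mul_left]
  refine tsum_congr fun k => ?_
  simp only [hf]
  rw [Odd.neg_pow ⟨k, rfl⟩, Nat.cast_mul, Nat.cast_ofNat]
  ring

lemma two_pow_mul_lam {n : ℕ} (hn : 2 ≤ n) : (2 ^ n * lam n : ℂ) = (2 ^ n - 1) * riemannZeta n := by
  have h := Li_sub_Li_neg hn (z := 1) (by simp)
  have hlam : (lam n : ℂ) = ∑' k : ℕ, 1 ^ (2 * k + 1) / (2 * (k : ℂ) + 1) ^ n := by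
    simp [lam, ofReal_tsum]
  rw [← hlam] at h
  rw [← Li_one_right hn]
  linear_combination -2 ^ n / 2 * h - Li_neg_one hn / 2

lemma lam_three_eq_zeta : (lam 3 : ℂ) = 7 / 8 * riemannZeta 3 := by
  have h := two_pow_mul_lam (n := 3) (by norm_num)
  push_cast at h
  linear_combination h / 8

lemma Li_three_one : Li 3 1 = ((8 / 7 * lam 3 : ℝ) : ℂ) := by
  rw [Li_one_right (by norm_num), Nat.cast_ofNat, ofReal_mul, lam_three_eq_zeta]
  push_cast
  ring

lemma im_Li_I {n : ℕ} (hn : 2 ≤ n) : (Li n I).im = beta n := by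
  have h := Li_sub_Li_neg hn (z := I) (by simp)
  have hterm (k : ℕ) : I ^ (2 * k + 1) / (2 * (k : ℂ) + 1) ^ n
      = (((-1) ^ k / (2 * (k : ℝ) + 1) ^ n : ℝ) : ℂ) * I := by
    rw [pow_succ, pow_mul, I_sq]
    push_cast
    ring
  have hsum : Summable fun k : ℕ => (-1 : ℝ) ^ k / (2 * (k : ℝ) + 1) ^ n := by
    refine .of_norm_bounded (summable_one_div_succ_pow hn) fun k => ?_
    rw [norm_div, norm_pow, norm_neg, norm_one, one_pow, Real.norm_of_nonneg (by positivity)]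
    gcongr
    linarith [k.cast_nonneg (α := ℝ)]
  have hbeta : beta n = ∑' k : ℕ, (-1 : ℝ) ^ k / (2 * (k : ℝ) + 1) ^ n :=
    tsum_eq_of_summable_unconditional hsum
  rw [Li_neg_I, tsum_congr hterm, tsum_mul_right, ← ofReal_tsum, ← hbeta, sub_conj,
    ← mul_assoc] at h
  have h' : 2 * (Li n I).im = 2 * beta n := by exact_mod_cast mul_right_cancel₀ I_ne_zero h
  linarith

lemma beta_three : beta 3 = Real.pi ^ 3 / 32 := by
  rw [← im_Li_I (by norm_num)]
  have h := Li_three_I_sub_conj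
  rw [sub_conj] at h
  have h' := mul_right_cancel₀ I_ne_zero h
  have : 2 * (Li 3 I).im = Real.pi ^ 3 / 16 := by exact_mod_cast h'
  linarith

lemma beta_one : beta 1 = Real.pi / 4 := by
  have h : HasSum (fun k : ℕ => (-1 : ℝ) ^ k / (2 * (k : ℝ) + 1) ^ 1) (Real.pi / 4)
      (SummationFilter.conditional ℕ) := by
    rw [HasSum, SummationFilter.conditional_filter_eq_map_range, tendsto_map'_iff]
    simp only [pow_one]
    exact Real.tendsto_sum_pi_div_four
  exact h.tsum_eq

lemma zetaTwo_eq : zetaTwo = Real.pi ^ 2 / 6 := by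
  have h : riemannZeta 2 = ((Real.pi ^ 2 / 6 : ℝ) : ℂ) := by
    rw [riemannZeta_two]
    push_cast
    rfl
  rw [zetaTwo, h, ofReal_re]

lemma L_natCast (n : ℕ) : L n = (-Real.log 2) ^ n / n.factorial := by
  simp [L]

end LambdaBeta

section RealAndImaginaryParts

lemma re_Li_three_I : (Li 3 I).re = -3 / 28 * lam 3 := by
  have h := congrArg re Li_three_I_add_conj
  simp only [add_re, conj_re, Li_three_one, mul_re, div_ofNat_re, neg_re, re_ofNat, ofReal_re,
    div_ofNat_im, neg_im, im_ofNat, neg_zero, zero_div, ofReal_im, mul_zero, sub_zero] at h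
  linarith

lemma im_Li_three_I : (Li 3 I).im = Real.pi ^ 3 / 32 := by
  rw [im_Li_I (by norm_num), beta_three]

lemma Li_three_half_eq_ofReal : Li 3 (1 / 2)
    = ((lam 3 + Real.log 2 ^ 3 / 6 - Real.pi ^ 2 * Real.log 2 / 12 : ℝ) : ℂ) := by
  have h := Li_three_half
  rw [Li_three_one] at h
  push_cast at h ⊢
  linear_combination h / 2

lemma re_Li_three_half :
    (Li 3 (1 / 2)).re = lam 3 + Real.log 2 ^ 3 / 6 - Real.pi ^ 2 * Real.log 2 / 12 := by
  rw [Li_three_half_eq_ofReal, ofReal_re]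

lemma im_Li_three_half : (Li 3 (1 / 2)).im = 0 := by
  rw [Li_three_half_eq_ofReal, ofReal_im]

lemma re_Li_three_one_add_I_div_two :
    (Li 3 ((1 + I) / 2)).re = 5 / 8 * lam 3 + Real.log 2 ^ 3 / 48
      - 5 / 192 * Real.pi ^ 2 * Real.log 2 := by
  have h := congrArg re Li_three_one_add_I_div_two_add_conj
  rw [Li_three_one] at h
  simp only [add_re, conj_re, re_Li_three_I, ← ofReal_pow, sub_re, ofReal_re, div_ofNat_re, mul_re,
    re_ofNat, div_ofNat_im, im_ofNat, zero_div, ofReal_im, mul_zero, sub_zero, mul_im, zero_mul,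
    add_zero, I_re, I_im, mul_one, sub_self] at h
  linarith

lemma re_Li_three_neg_eighth :
    (Li 3 (-1 / 8)).re - 18 * (Li 3 (-1 / 2)).re = 14 * lam 3 + 3 / 2 * Real.log 2 ^ 3
      - Real.pi ^ 2 * Real.log 2 := by
  have h := congrArg re Li_three_neg_eighth
  rw [Li_three_one] at h
  simp only [sub_re, mul_re, re_ofNat, im_ofNat, zero_mul, sub_zero, ← ofReal_pow, add_re,
    div_ofNat_re, ofReal_re, div_ofNat_im, zero_div, ofReal_im, mul_zero] at h
  linarith

lemma re_Li_three_one_add_I_div_four :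
    (Li 3 ((1 + I) / 4)).re - 9 / 4 * (Li 3 (I / 2)).re
      = 3 / 4 * lam 3 + 3 / 16 * Real.log 2 ^ 3 - 5 / 64 * Real.pi ^ 2 * Real.log 2 := by
  have h := congrArg re Li_three_one_add_I_div_four
  rw [Li_three_one] at h
  simp only [add_re, sub_re, mul_re, div_ofNat_re, re_ofNat, conj_re, div_ofNat_im, im_ofNat,
    zero_div, conj_im, mul_neg, zero_mul, neg_zero, sub_zero, ofReal_re, ofReal_im, mul_zero, ←
    ofReal_pow, neg_re, neg_im, mul_im, add_zero, I_re, sub_im, sub_self, I_im, mul_one] at h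
  linarith [re_Li_three_I, re_Li_three_half, re_Li_three_one_add_I_div_two]

lemma im_Li_three_one_add_I_div_four :
    (Li 3 ((1 + I) / 4)).im + 9 / 4 * (Li 3 (I / 2)).im - 6 * (Li 3 ((1 + I) / 2)).im
      = 3 / 32 * Real.pi * Real.log 2 ^ 2 - 9 / 128 * Real.pi ^ 3 := by
  have h := congrArg im Li_three_one_add_I_div_four
  rw [Li_three_one] at h
  simp only [add_im, sub_im, mul_im, div_ofNat_re, re_ofNat, conj_im, mul_neg, div_ofNat_im,
    im_ofNat, zero_div, conj_re, zero_mul, add_zero, sub_neg_eq_add, ofReal_im, mul_zero, ofReal_re,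
    ← ofReal_pow, neg_re, neg_im, neg_zero, mul_re, sub_zero, sub_re, I_im, mul_one, sub_self, I_re,
    zero_add] at h
  linarith [im_Li_three_I, im_Li_three_half]

lemma re_Li_three_one_add_I_div_eight :
    (Li 3 ((1 + I) / 8)).re - 7 / 2 * (Li 3 (I / 2)).re - 4 * (Li 3 ((1 + I) / 4)).re
      = -3 / 2 * lam 3 - 11 / 48 * Real.log 2 ^ 3 + 25 / 192 * Real.pi ^ 2 * Real.log 2 := by
  have h := congrArg re Li_three_one_add_I_div_eight
  rw [Li_three_one] at h
  simp only [add_re, sub_re, mul_re, div_ofNat_re, re_ofNat, conj_re, div_ofNat_im, im_ofNat,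
    zero_div, conj_im, mul_neg, zero_mul, neg_zero, sub_zero, ofReal_re, ofReal_im, mul_zero, ←
    ofReal_pow, neg_re, neg_im, mul_im, add_zero, I_re, sub_im, sub_self, I_im, mul_one] at h
  linarith [re_Li_three_one_add_I_div_two]

lemma im_Li_three_one_add_I_div_eight :
    (Li 3 ((1 + I) / 8)).im - 7 / 2 * (Li 3 (I / 2)).im + 4 * (Li 3 ((1 + I) / 4)).im
        - 4 * (Li 3 ((1 + I) / 2)).im
      = 7 / 32 * Real.pi * Real.log 2 ^ 2 - 13 / 128 * Real.pi ^ 3 := by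
  have h := congrArg im Li_three_one_add_I_div_eight
  rw [Li_three_one] at h
  simp only [add_im, sub_im, mul_im, div_ofNat_re, re_ofNat, conj_im, mul_neg, div_ofNat_im,
    im_ofNat, zero_div, conj_re, zero_mul, add_zero, sub_neg_eq_add, ofReal_im, mul_zero, ofReal_re,
    ← ofReal_pow, neg_re, neg_im, neg_zero, mul_re, sub_zero, sub_re, I_im, mul_one, sub_self, I_re,
    zero_add] at h
  linarith

end RealAndImaginaryParts

section LadderTerms

lemma zpow_natCast_succ_sub_one (z : ℂ) (n : ℕ) : z ^ (((n + 1 : ℕ) : ℤ) - 1) = z ^ n := by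
  rw [Nat.cast_succ, add_sub_cancel_right, zpow_natCast]

lemma re_ofReal_pow_mul (x : ℝ) (n : ℕ) (z : ℂ) : ((x : ℂ) ^ n * z).re = x ^ n * z.re := by
  rw [← ofReal_pow, re_ofReal_mul]

lemma im_ofReal_pow_mul (x : ℝ) (n : ℕ) (z : ℂ) : ((x : ℂ) ^ n * z).im = x ^ n * z.im := by
  rw [← ofReal_pow, im_ofReal_mul]

variable (n : ℕ)

lemma B_succ : B (n + 1) = 2 ^ n * (Li (n + 1) ((1 + I) / 2)).re := by
  rw [B, zpow_natCast_succ_sub_one]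
  exact_mod_cast re_ofReal_pow_mul 2 n _

lemma F_succ : F (n + 1) = 2 ^ n * (Li (n + 1) ((1 + I) / 2)).im := by
  rw [F, zpow_natCast_succ_sub_one]
  exact_mod_cast im_ofReal_pow_mul 2 n _

lemma D_succ : D (n + 1)
    = (2 / 3) ^ n * (Li (n + 1) ((1 + I) / 4)).re - (Li (n + 1) (I / 2)).re := by
  have h := re_ofReal_pow_mul (2 / 3) n (Li (n + 1) ((1 + I) / 4))
  push_cast at h
  rw [D, zpow_natCast_succ_sub_one, sub_re, h, Li_neg_I_div_two, conj_re]

lemma G_succ : G (n + 1)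
    = (2 / 3) ^ n * (Li (n + 1) ((1 + I) / 4)).im + (Li (n + 1) (I / 2)).im := by
  have h := im_ofReal_pow_mul (2 / 3) n (Li (n + 1) ((1 + I) / 4))
  push_cast at h
  rw [G, zpow_natCast_succ_sub_one, sub_im, h, Li_neg_I_div_two, conj_im, sub_neg_eq_add]

lemma E_succ : E (n + 1)
    = (2 / 5) ^ n * (Li (n + 1) ((1 + I) / 8)).re - 2 * (Li (n + 1) (I / 2)).re := by
  have h := re_ofReal_pow_mul (2 / 5) n (Li (n + 1) ((1 - I) / 8))
  push_cast at h
  have h' := re_ofReal_mul 2 (Li (n + 1) (-I / 2))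
  rw [ofReal_ofNat] at h'
  rw [E, zpow_natCast_succ_sub_one, sub_re, h, h', Li_neg_I_div_two, Li_one_sub_I_div, conj_re,
    conj_re]

lemma H_succ : H (n + 1)
    = -((2 / 5) ^ n * (Li (n + 1) ((1 + I) / 8)).im) + 2 * (Li (n + 1) (I / 2)).im := by
  have h := im_ofReal_pow_mul (2 / 5) n (Li (n + 1) ((1 - I) / 8))
  push_cast at h
  have h' := im_ofReal_mul 2 (Li (n + 1) (-I / 2))
  rw [ofReal_ofNat] at h'
  rw [H, zpow_natCast_succ_sub_one, sub_im, h, h', Li_neg_I_div_two, Li_one_sub_I_div, conj_im,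
    conj_im]
  ring

variable {n}

lemma two_pow_mul_re_Li_of_re_eq_zero (hn : 2 ≤ n) {z : ℂ} (hz : ‖z‖ ≤ 1) (hre : z.re = 0) :
    2 ^ n * (Li n z).re = (Li n (z ^ 2)).re := by
  have hconj : -z = (starRingEnd ℂ) z := by
    apply Complex.ext <;> simp [hre]
  have h := Li_sq hn hz
  rw [hconj, Li_conj, add_conj] at h
  have h' := congrArg re h
  rw [← ofReal_ofNat, re_ofReal_mul, re_ofReal_pow_mul, ofReal_re] at h'
  linarith

lemma C_succ (hn : 1 ≤ n) : C (n + 1)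
    = (1 / 3) ^ n / 2 * (Li (n + 1) (-1 / 8)).re - (Li (n + 1) (-1 / 2)).re := by
  have hsqrt_inv_le {x : ℝ} (hx : 1 ≤ x) (s : ℂ) (hs : ‖s‖ = 1) : ‖s / (√x : ℝ)‖ ≤ 1 := by
    rw [norm_div, hs, norm_real, Real.norm_of_nonneg (Real.sqrt_nonneg x)]
    exact div_le_one_of_le₀ (Real.one_le_sqrt.2 hx) (Real.sqrt_nonneg x)
  have hsq (x : ℝ) (hx : 0 ≤ x) : (((√x : ℝ) : ℂ)) ^ 2 = x := by
    exact_mod_cast Real.sq_sqrt hx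
  have h8 := two_pow_mul_re_Li_of_re_eq_zero (n := n + 1) (by lia)
    (hsqrt_inv_le (x := 8) (by norm_num) I norm_I) (by simp)
  have h2 := two_pow_mul_re_Li_of_re_eq_zero (n := n + 1) (by lia)
    (hsqrt_inv_le (x := 2) (by norm_num) (-I) (by simp)) (by simp)
  rw [div_pow, hsq _ (by norm_num), I_sq, ofReal_ofNat] at h8
  rw [div_pow, hsq _ (by norm_num), neg_sq, I_sq, ofReal_ofNat] at h2
  have h₁ := re_ofReal_pow_mul (2 / 3) n (Li (n + 1) (I / (√8 : ℝ)))
  have h₂ := re_ofReal_pow_mul 2 (n + 1) (Li (n + 1) (-I / (√2 : ℝ)))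
  push_cast at h₁ h₂
  rw [C, zpow_natCast_succ_sub_one, sub_re, h₁, h₂, h2, ← h8, div_pow, div_pow, one_pow]
  ring

end LadderTerms

section Ladders

lemma L_one : L 1 = -Real.log 2 := by
  simpa using L_natCast 1

lemma L_two : L 2 = Real.log 2 ^ 2 / 2 := by
  simpa using L_natCast 2

lemma L_three : L 3 = -Real.log 2 ^ 3 / 6 := by
  rw [← Odd.neg_pow (by decide)]
  exact_mod_cast L_natCast 3

lemma lam_three_eq_Abar : lam 3 = Abar 3 := by
  have h := re_Li_three_half
  rw [Abar, A, zetaTwo_eq, show ((3 : ℕ) : ℤ) - 2 = 1 from rfl, Nat.cast_ofNat, L_one, L_three]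
  linarith

lemma lam_three_eq_Bbar : lam 3 = 2 / 5 * Bbar 3 := by
  have h := re_Li_three_one_add_I_div_two
  rw [Bbar, B_succ 2, zetaTwo_eq,
    show ((3 : ℕ) : ℤ) - 2 = 1 from rfl, Nat.cast_ofNat, L_one, L_three]
  linarith

lemma lam_three_eq_Cbar : lam 3 = 9 / 7 * Cbar 3 := by
  have h := re_Li_three_neg_eighth
  rw [Cbar, C_succ (n := 2) (by norm_num), zetaTwo_eq, show ((3 : ℕ) : ℤ) - 2 = 1 from rfl,
    Nat.cast_ofNat, L_one, L_three]
  linarith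

lemma lam_three_eq_Dbar : lam 3 = 3 * Dbar 3 := by
  have h := re_Li_three_one_add_I_div_four
  rw [Dbar, D_succ 2, zetaTwo_eq, show ((3 : ℕ) : ℤ) - 2 = 1 from rfl, Nat.cast_ofNat, L_one,
    L_three]
  linarith

lemma lam_three_eq_Ebar : lam 3 = 25 / 6 * Ebar 3 := by
  have h := re_Li_three_one_add_I_div_four
  have h' := re_Li_three_one_add_I_div_eight
  rw [Ebar, E_succ 2, zetaTwo_eq, show ((3 : ℕ) : ℤ) - 2 = 1 from rfl, Nat.cast_ofNat, L_one,
    L_three]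
  linarith

lemma beta_three_eq_Fbar_sub_Gbar : beta 3 = 2 / 3 * Fbar 3 - Gbar 3 := by
  have h := im_Li_three_one_add_I_div_four
  rw [Fbar, Gbar, F_succ 2, G_succ 2, show ((3 : ℕ) : ℤ) - 1 = 2 from rfl, L_two, beta_one,
    beta_three]
  linarith

lemma beta_three_eq_Fbar_sub_Hbar : beta 3 = 20 / 23 * Fbar 3 - 25 / 23 * Hbar 3 := by
  have h := im_Li_three_one_add_I_div_four
  have h' := im_Li_three_one_add_I_div_eight
  rw [Fbar, Hbar, F_succ 2, H_succ 2, show ((3 : ℕ) : ℤ) - 1 = 2 from rfl, L_two, beta_one,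
    beta_three]
  linarith

end Ladders

section Series

lemma S_vec {n : ℕ} (hn : 2 ≤ n) (p : ℕ) (a₀ a₁ a₂ a₃ a₄ a₅ a₆ a₇ : ℤ) :
    S n p ![a₀, a₁, a₂, a₃, a₄, a₅, a₆, a₇] = a₀ * S n p (Pi.single 0 1)
      + a₁ * S n p (Pi.single 1 1) + a₂ * S n p (Pi.single 2 1) + a₃ * S n p (Pi.single 3 1)
      + a₄ * S n p (Pi.single 4 1) + a₅ * S n p (Pi.single 5 1) + a₆ * S n p (Pi.single 6 1)
      + a₇ * S n p (Pi.single 7 1) := by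
  rw [S_eq_sum hn, Fin.sum_univ_eight]
  rfl

lemma re_Li_three_half_eq_S :
    (Li 3 (1 / 2)).re = 8 * S 3 1 ![0, 1, 0, 1, 0, 1, 0, 1] := by
  convert! re_Li_one_div_two_pow (n := 3) (by norm_num) 1 using 2 <;> norm_num

lemma re_Li_three_neg_half_eq_S :
    (Li 3 (-1 / 2)).re = 8 * S 3 1 ![0, -1, 0, 1, 0, -1, 0, 1] := by
  convert! re_Li_neg_one_div_two_pow (n := 3) (by norm_num) 1 using 2 <;> norm_num

lemma re_Li_three_neg_eighth_eq_S :
    (Li 3 (-1 / 8)).re = 16 * S 3 3 ![0, -1, 0, 1, 0, -1, 0, 1] := by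
  convert! re_Li_neg_one_div_two_pow (n := 3) (by norm_num) 3 using 2 <;> norm_num

lemma re_Li_three_I_div_two_eq_S :
    (Li 3 (I / 2)).re = 8 * S 3 1 ![0, 0, 0, -1, 0, 0, 0, 1] := by
  convert! re_Li_I_div_two_pow (n := 3) (by norm_num) 1 using 2 <;> norm_num

lemma im_Li_three_I_div_two_eq_S :
    (Li 3 (I / 2)).im = 8 * S 3 1 ![0, 1, 0, 0, 0, -1, 0, 0] := by
  convert! im_Li_I_div_two_pow (n := 3) (by norm_num) 1 using 2 <;> norm_num

lemma re_Li_three_one_add_I_div_two_eq_S :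
    (Li 3 ((1 + I) / 2)).re = S 3 1 ![1, 0, -1, -1, -1, 0, 1, 1] := by
  convert! re_Li_one_add_I_div_two_pow (n := 3) (by norm_num) 0 using 2 <;> norm_num

lemma im_Li_three_one_add_I_div_two_eq_S :
    (Li 3 ((1 + I) / 2)).im = S 3 1 ![1, 1, 1, 0, -1, -1, -1, 0] := by
  convert! im_Li_one_add_I_div_two_pow (n := 3) (by norm_num) 0 using 2 <;> norm_num

lemma re_Li_three_one_add_I_div_four_eq_S :
    (Li 3 ((1 + I) / 4)).re = 2 * S 3 3 ![1, 0, -1, -1, -1, 0, 1, 1] := by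
  convert! re_Li_one_add_I_div_two_pow (n := 3) (by norm_num) 1 using 2 <;> norm_num

lemma im_Li_three_one_add_I_div_four_eq_S :
    (Li 3 ((1 + I) / 4)).im = 2 * S 3 3 ![1, 1, 1, 0, -1, -1, -1, 0] := by
  convert! im_Li_one_add_I_div_two_pow (n := 3) (by norm_num) 1 using 2 <;> norm_num

lemma im_Li_three_one_add_I_div_eight_eq_S :
    (Li 3 ((1 + I) / 8)).im = 4 * S 3 5 ![1, 1, 1, 0, -1, -1, -1, 0] := by
  convert! im_Li_one_add_I_div_two_pow (n := 3) (by norm_num) 2 using 2 <;> norm_num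

lemma log_two_cubed_eq_S :
    Real.log 2 ^ 3 = 192 * S 3 1 ![0, 1, 0, 4, 0, 1, 0, 16]
      - 32 * S 3 3 ![4, -3, -4, -1, -4, -3, 4, 7] := by
  have h₁ := re_Li_three_half
  have h₂ := re_Li_three_neg_eighth
  have h₃ := re_Li_three_one_add_I_div_four
  rw [re_Li_three_half_eq_S] at h₁
  rw [re_Li_three_neg_eighth_eq_S, re_Li_three_neg_half_eq_S] at h₂
  rw [re_Li_three_one_add_I_div_four_eq_S, re_Li_three_I_div_two_eq_S] at h₃
  simp only [S_vec (n := 3) (by norm_num)] at h₁ h₂ h₃ ⊢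
  push_cast at h₁ h₂ h₃ ⊢
  linarith

lemma lam_three_eq_S :
    lam 3 = 6 * S 3 1 ![1, -7, -1, 10, -1, -7, 1, 0] + 4 * S 3 3 ![1, 1, -1, -2, -1, 1, 1, 0] := by
  have h₁ := re_Li_three_half
  have h₂ := re_Li_three_one_add_I_div_two
  have h₃ := re_Li_three_neg_eighth
  have h₄ := re_Li_three_one_add_I_div_four
  rw [re_Li_three_half_eq_S] at h₁
  rw [re_Li_three_one_add_I_div_two_eq_S] at h₂
  rw [re_Li_three_neg_eighth_eq_S, re_Li_three_neg_half_eq_S] at h₃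
  rw [re_Li_three_one_add_I_div_four_eq_S, re_Li_three_I_div_two_eq_S] at h₄
  simp only [S_vec (n := 3) (by norm_num)] at h₁ h₂ h₃ h₄ ⊢
  push_cast at h₁ h₂ h₃ h₄ ⊢
  linarith

lemma pi_cubed_eq_S : Real.pi ^ 3 / 32 = 5 * S 3 1 ![1, -6, 1, 0, -1, 6, -1, 0]
    + 5 / 3 * S 3 3 ![1, 1, 1, 0, -1, -1, -1, 0] + 2 * S 3 5 ![1, 1, 1, 0, -1, -1, -1, 0] := by
  have h₁ := im_Li_three_one_add_I_div_four
  have h₂ := im_Li_three_one_add_I_div_eight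
  rw [im_Li_three_one_add_I_div_four_eq_S, im_Li_three_I_div_two_eq_S,
    im_Li_three_one_add_I_div_two_eq_S] at h₁
  rw [im_Li_three_one_add_I_div_eight_eq_S, im_Li_three_I_div_two_eq_S,
    im_Li_three_one_add_I_div_four_eq_S, im_Li_three_one_add_I_div_two_eq_S] at h₂
  simp only [S_vec (n := 3) (by norm_num)] at h₁ h₂ ⊢
  push_cast at h₁ h₂ ⊢
  linarith

end Series

end

end Ladder

theorem mainTheorem3 :
    -- the real ladders
    (Ladder.lam 3 = Ladder.Abar 3 ∧
      Ladder.lam 3 = 2 / 5 * Ladder.Bbar 3 ∧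
      Ladder.lam 3 = 9 / 7 * Ladder.Cbar 3 ∧
      Ladder.lam 3 = 3 * Ladder.Dbar 3 ∧
      Ladder.lam 3 = 25 / 6 * Ladder.Ebar 3) ∧
    -- the imaginary ladders
    (Ladder.beta 3 = Real.pi ^ 3 / 32 ∧
      Ladder.beta 3 = 2 / 3 * Ladder.Fbar 3 - Ladder.Gbar 3 ∧
      Ladder.beta 3 = 20 / 23 * Ladder.Fbar 3 - 25 / 23 * Ladder.Hbar 3) ∧
    -- the series for `log³ 2`
    (Real.log 2 ^ 3 =
      192 * Ladder.S 3 1 ![0, 1, 0, 4, 0, 1, 0, 16]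
        - 32 * Ladder.S 3 3 ![4, -3, -4, -1, -4, -3, 4, 7]) ∧
    -- the series for `λ(3) = (7/8) ζ(3)`
    ((Ladder.lam 3 : ℂ) = 7 / 8 * riemannZeta 3 ∧
      Ladder.lam 3 =
        6 * Ladder.S 3 1 ![1, -7, -1, 10, -1, -7, 1, 0]
          + 4 * Ladder.S 3 3 ![1, 1, -1, -2, -1, 1, 1, 0]) ∧
    -- the series for `β(3) = π³/32`
    (Real.pi ^ 3 / 32 =
      5 * Ladder.S 3 1 ![1, -6, 1, 0, -1, 6, -1, 0]
        + 5 / 3 * Ladder.S 3 3 ![1, 1, 1, 0, -1, -1, -1, 0]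
        + 2 * Ladder.S 3 5 ![1, 1, 1, 0, -1, -1, -1, 0]) :=
  ⟨⟨Ladder.lam_three_eq_Abar, Ladder.lam_three_eq_Bbar, Ladder.lam_three_eq_Cbar,
      Ladder.lam_three_eq_Dbar, Ladder.lam_three_eq_Ebar⟩,
    ⟨Ladder.beta_three, Ladder.beta_three_eq_Fbar_sub_Gbar, Ladder.beta_three_eq_Fbar_sub_Hbar⟩,
    Ladder.log_two_cubed_eq_S,
    ⟨Ladder.lam_three_eq_zeta, Ladder.lam_three_eq_S⟩,
    Ladder.pi_cubed_eq_S⟩
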